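/- Let $\mathbb{E}$ be a real vector space of finite dimension $n$ with dual $\mathbb{E}^*$ and pairing $\langle s,x\rangle$. For self-adjoint operators $A_1,A_2:\mathbb{E}\to\mathbb{E}^*$ write $A_1\preceq A_2$ if $\langle (A_2-A_1)h,h\rangle\ge 0$ for all $h\in\mathbb{E}$. For a self-adjoint positive definite $A:\mathbb{E}\to\mathbb{E}^*$ put $\|h\|_A=\langle Ah,h\rangle^{1/2}$ and $\|s\|_A^*=\langle s,A^{-1}s\rangle^{1/2}$. For self-adjoint positive definite $A,G:\mathbb{E}\to\mathbb{E}^*$, $u\in\mathbb{E}$ and $\tau\in[0,1]$, let $\mathrm{Broyd}_\tau(A,G,u)=G$ if $u=0$, and otherwise $$\mathrm{Broyd}_\tau(A,G,u)=\phi\Big[G-\tfrac{Auu^*G+Guu^*A}{\langle Au,u\rangle}+\Big(\tfrac{\langle Gu,u\rangle}{\langle Au,u\rangle}+1\Big)\tfrac{Auu^*A}{\langle Au,u\rangle}\Big]+(1-\phi)\Big[G-\tfrac{Guu^*G}{\langle Gu,u\rangle}+\tfrac{Auu^*A}{\langle Au,u\rangle}\Big],$$ where $uu^*:\mathbb{E}^*\to\mathbb{E}$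 is $s\mapsto\langle s,u\rangle u$ and $$\phi=\frac{\tau\frac{\langle Au,u\rangle}{\langle AG^{-1}Au,u\rangle}}{\tau\frac{\langle Au,u\rangle}{\langle AG^{-1}Au,u\rangle}+(1-\tau)\frac{\langle Gu,u\rangle}{\langle Au,u\rangle}} .$$ Let $f:\mathbb{E}\to\mathbb{R}$ be twice continuously differentiable, let $B:\mathbb{E}\to\mathbb{E}^*$ be self-adjoint positive definite, and let $\mu,L>0$ and $M\ge 0$ be such that, for all $x,y,z,w\in\mathbb{E}$, $$\mu B\preceq\nabla^2 f(x)\preceq LB,\qquad \nabla^2 f(y)-\nabla^2 f(x)\preceq M\,\|y-x\|_{\nabla^2 f(z)}\,\nabla^2 f(w).$$ Consider the quasi-Newton scheme with arbitrary $x_0\in\mathbb{E}$, $G_0=LB$ and, for $k\ge 0$, with arbitrary $\tau_k\in[0,1]$, $$x_{k+1}=x_k-G_k^{-1}\nabla f(x_k),\quad u_k=x_{k+1}-x_k,\quad J_k=\int_0^1\nabla^2 f(x_k+tu_k)\,dt,\quad G_{k+1}=\mathrm{Broyd}_{\tau_k}(J_k,G_k,u_k).$$ Put $\lambda_k=\|\nabla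 f(x_k)\|^*_{\nabla^2 f(x_k)}$ and $\tau=\sup_{k\ge 0}\tau_k$, and let $K_0$ be the smallest positive integer with $$K_0\ \ge\ \frac{8n\ln\frac{2L}{\mu}}{\tau\frac{4\mu}{9L}+1-\tau}.$$ Suppose that $$M\lambda_0\le\frac{\ln\frac32}{(\frac32)^{3/2}}\max\Big\{\frac{\mu}{2L},\frac{1}{K_0+9}\Big\}.$$ Then, for all $k\ge 0$, $$\tfrac23\nabla^2 f(x_k)\preceq G_k\preceq\tfrac{3L}{2\mu}\nabla^2 f(x_k),\qquad \lambda_k\le\Big(1-\frac{\mu}{2L}\Big)^k\sqrt{\tfrac32}\,\lambda_0,$$ and, for all $k\ge 1$, $$\lambda_k\le\left[\frac{5}{2\prod_{i=0}^{k-1}\big(\tau_i\frac{4\mu}{9L}+1-\tau_i\big)^{1/k}}\Big(e^{\frac{13}{6}\frac nk\ln\frac{2L}{\mu}}-1\Big)\right]^{k/2}\sqrt{\frac{3L}{2\mu}}\;\lambda_0 .$$ -/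

import Mathlib

namespace QuasiNewton

noncomputable section

/-- Continuous linear operators from a real normed space to its dual. In finite dimension every
linear operator is of this kind. `A h k` is the pairing `⟨A h, k⟩`. -/
abbrev Op (E : Type*) [NormedAddCommGroup E] [NormedSpace ℝ E] : Type _ :=
  E →L[ℝ] StrongDual ℝ E

/-- `A` is self-adjoint and positive definite. -/
structure IsPosDef {E : Type*} [NormedAddCommGroup E] [NormedSpace ℝ E] (A : Op E) : Prop where
  symm : ∀ x y : E, A x y = A y x
  pos : ∀ x : E, x ≠ 0 → 0 < A x x

/-- The order `A₁ ⪯ A₂` on self-adjoint operators: `⟨(A₂ - A₁) h, h⟩ ≥ 0` for all `h`. -/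
def OpLE {E : Type*} [NormedAddCommGroup E] [NormedSpace ℝ E] (A₁ A₂ : Op E) : Prop :=
  ∀ h : E, 0 ≤ (A₂ - A₁) h h

/-- The norm `‖h‖_A = ⟨A h, h⟩^{1/2}`. -/
def primalNorm {E : Type*} [NormedAddCommGroup E] [NormedSpace ℝ E] (A : Op E) (h : E) : ℝ :=
  Real.sqrt (A h h)

/-- The conjugate norm `‖s‖_A^* = ⟨s, A⁻¹ s⟩^{1/2}`. -/
def dualNorm {E : Type*} [NormedAddCommGroup E] [NormedSpace ℝ E] (A : Op E)
    (s : StrongDual ℝ E) : ℝ :=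
  Real.sqrt (s (A.inverse s))

/-- The gradient `∇f(x) ∈ E*`. -/
def grad {E : Type*} [NormedAddCommGroup E] [NormedSpace ℝ E] (f : E → ℝ) (x : E) :
    StrongDual ℝ E :=
  fderiv ℝ f x

/-- The Hessian `∇²f(x) : E → E*`. -/
def hess {E : Type*} [NormedAddCommGroup E] [NormedSpace ℝ E] (f : E → ℝ) (x : E) : Op E :=
  fderiv ℝ (fun y => grad f y) x

/-- The integral Hessian `∫₀¹ ∇²f(x + t u) dt`. -/
def integralHess {E : Type*} [NormedAddCommGroup E] [NormedSpace ℝ E] (f : E → ℝ) (x u : E) :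
    Op E :=
  ∫ t in (0 : ℝ)..1, hess f (x + t • u)

/-- `f` is `M`-strongly self-concordant:
`∇²f(y) - ∇²f(x) ⪯ M ‖y - x‖_{∇²f(z)} ∇²f(w)` for all `x, y, z, w`. -/
def StronglySelfConcordant {E : Type*} [NormedAddCommGroup E] [NormedSpace ℝ E] (f : E → ℝ)
    (M : ℝ) : Prop :=
  ∀ x y z w : E,
    OpLE (hess f y - hess f x) ((M * primalNorm (hess f z) (y - x)) • hess f w)

/-- The rank-one operator `u u^* : E* → E`, `s ↦ ⟨s, u⟩ u`. -/
def dyad {E : Type*} [NormedAddCommGroup E] [NormedSpace ℝ E] (u : E) : StrongDual ℝ E →L[ℝ] E :=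
  (ContinuousLinearMap.apply ℝ ℝ u).smulRight u

/-- The DFP update
`G - (A u u^* G + G u u^* A) / ⟨A u, u⟩ + (⟨G u, u⟩ / ⟨A u, u⟩ + 1) A u u^* A / ⟨A u, u⟩`. -/
def dfp {E : Type*} [NormedAddCommGroup E] [NormedSpace ℝ E] (A G : Op E) (u : E) : Op E :=
  G - (1 / A u u) • (A.comp ((dyad u).comp G) + G.comp ((dyad u).comp A))
    + ((G u u / A u u + 1) / A u u) • A.comp ((dyad u).comp A)

/-- The BFGS update `G - G u u^* G / ⟨G u, u⟩ + A u u^* A / ⟨A u, u⟩`. -/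
def bfgs {E : Type*} [NormedAddCommGroup E] [NormedSpace ℝ E] (A G : Op E) (u : E) : Op E :=
  G - (1 / G u u) • G.comp ((dyad u).comp G) + (1 / A u u) • A.comp ((dyad u).comp A)

/-- The weight `φ_τ(A, G, u)` of the DFP update inside the Broyden class. -/
def phi {E : Type*} [NormedAddCommGroup E] [NormedSpace ℝ E] (τ : ℝ) (A G : Op E) (u : E) : ℝ :=
  (τ * (A u u / A (G.inverse (A u)) u)) /
    (τ * (A u u / A (G.inverse (A u)) u) + (1 - τ) * (G u u / A u u))

open Classical in
/-- The Broyden update `Broyd_τ(A, G, u)`, equal to `G` for `u = 0`. -/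
def broyd {E : Type*} [NormedAddCommGroup E] [NormedSpace ℝ E] (τ : ℝ) (A G : Op E) (u : E) :
    Op E :=
  if u = 0 then G else phi τ A G u • dfp A G u + (1 - phi τ A G u) • bfgs A G u

/-- `x, G, τ` are a run of the quasi-Newton scheme for `f` with updates from the convex Broyden
class, started from `x 0` and `G 0 = L B`, with the step parameters `τ k ∈ [0, 1]`. -/
structure IsScheme {E : Type*} [NormedAddCommGroup E] [NormedSpace ℝ E] (f : E → ℝ) (B : Op E)
    (L : ℝ) (x : ℕ → E) (G : ℕ → Op E) (τ : ℕ → ℝ) : Prop where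
  init : G 0 = L • B
  tau_mem : ∀ k, τ k ∈ Set.Icc (0 : ℝ) 1
  step : ∀ k, x (k + 1) = x k - (G k).inverse (grad f (x k))
  update : ∀ k, G (k + 1) =
    broyd (τ k) (integralHess f (x k) (x (k + 1) - x k)) (G k) (x (k + 1) - x k)

/-- The local gradient norm `‖∇f(x)‖_{∇²f(x)}^*`. -/
def localGradNorm {E : Type*} [NormedAddCommGroup E] [NormedSpace ℝ E] (f : E → ℝ) (x : E) : ℝ :=
  dualNorm (hess f x) (grad f x)

/-- `τ (4 μ / (9 L)) + 1 - τ`. -/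
def weight (μ L τ : ℝ) : ℝ :=
  τ * (4 * μ / (9 * L)) + 1 - τ

/-- The starting moment `K₀` of superlinear convergence: the smallest positive integer that is at
least `8 n ln(2 L / μ) / (τ (4 μ / (9 L)) + 1 - τ)`. -/
def startMoment (n : ℕ) (μ L τ : ℝ) : ℕ :=
  max 1 ⌈1 / weight μ L τ * (8 * n * Real.log (2 * L / μ))⌉₊

end

end QuasiNewton

/-! Write H_k for the Hessian at x_k, r_k = ‖u_k‖_{H_k}, and p_k = M(r_0 + … + r_{k-1}), which is
`pathLength`. The convergence estimates are proved under the condition p_k ≤ ln(3/2). The smallness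
of Mλ_0 serves only to secure this condition.

Spectral bounds. For ξ, η ≥ 1 a Broyden update with target J preserves J ⪯ ξG and G ⪯ ηJ
(`le_broyd`, `broyd_le`). By strong self-concordance each exchange among H_k, J_k, H_{k+1} costs a
factor 1 + Mr_k/2, so H_k ⪯ e^{p_k}G_k and G_k ⪯ e^{p_k}(L/μ)H_k (`Run.bounds`). Since ∇f(x_{k+1}) =
(J_k − G_k)u_k, these bounds make each step a contraction (`IsPosDef.contraction`), which yields the
linear rate.

Superlinear rate. The potential tr(G⁻¹A) − ln det(G⁻¹A) − n measures how far G is from A. With ω_k =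
`weight μ L (τ k)`, one update lowers it by at least (6/13) ln(1 + ω_k ρ_k), while the squared
gradient norm in the metric of G_k⁻¹ is multiplied by at most (5/2)ρ_k (`broyd_step`). The decreases
sum to at most n ln(2L/μ) (`Run.sum_decrease_le`), and superadditivity of the geometric mean turns
this into a bound on ∏ρ_i.

Closing the loop. In `Run.pathLength_le`, p_k ≤ ln(3/2) is proved by induction from r_k ≤ (3/2)λ_k
and a bound on Σλ_j: at most √(3/2)λ_0 times 2L/μ by the linear rate, or times K_0 + 9 by the
superlinear rate after K_0. -/

namespace QuasiNewton

/-! ### Positive definite operators, their inverses and the contraction of a step -/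

section PosDef

variable {E : Type*} [NormedAddCommGroup E] [NormedSpace ℝ E]

lemma IsPosDef.nonneg {A : Op E} (hA : IsPosDef A) (x : E) : 0 ≤ A x x := by
  rcases eq_or_ne x 0 with rfl | hx
  · simp
  · exact (hA.pos x hx).le

/-- The Cauchy–Schwarz inequality for a positive definite operator. -/
lemma IsPosDef.cauchy_schwarz {A : Op E} (hA : IsPosDef A) (x y : E) :
    (A x y) ^ 2 ≤ A x x * A y y := by
  rcases eq_or_ne y 0 with rfl | hy
  · simp
  have hpos := hA.pos y hy
  have h := hA.nonneg (A y y • x - A x y • y)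
  simp only [map_sub, map_smul, sub_apply, smul_apply,
    smul_eq_mul, hA.symm y x] at h
  have h' : 0 ≤ A y y * (A x x * A y y - (A x y) ^ 2) := by linarith
  linarith [nonneg_of_mul_nonneg_right h' hpos]

lemma opLE_iff {A₁ A₂ : Op E} : OpLE A₁ A₂ ↔ ∀ h, A₁ h h ≤ A₂ h h := by
  simp [OpLE]

lemma IsPosDef.smul {A : Op E} (hA : IsPosDef A) {c : ℝ} (hc : 0 < c) : IsPosDef (c • A) where
  symm x y := by simp [hA.symm x y]
  pos x hx := by simpa using mul_pos hc (hA.pos x hx)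

/-- A self-adjoint operator above a positive multiple of a positive definite one is positive
definite. -/
lemma IsPosDef.of_le {A G : Op E} (hA : IsPosDef A) (hG : ∀ x y, G x y = G y x) {c : ℝ}
    (hc : 0 < c) (h : ∀ x, c * A x x ≤ G x x) : IsPosDef G where
  symm := hG
  pos x hx := (mul_pos hc (hA.pos x hx)).trans_le (h x)

@[simp] lemma dyad_apply (u : E) (s : StrongDual ℝ E) : dyad u s = s u • u := rfl

variable [FiniteDimensional ℝ E]

lemma IsPosDef.bijective {A : Op E} (hA : IsPosDef A) : Function.Bijective A := by
  have hinj : Function.Injective (A : E →ₗ[ℝ] StrongDual ℝ E) := by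
    rw [← LinearMap.ker_eq_bot, LinearMap.ker_eq_bot']
    intro x hx
    by_contra hne
    have := hA.pos x hne
    rw [show A x = 0 from hx] at this
    simp at this
  have hfin : Module.finrank ℝ E = Module.finrank ℝ (StrongDual ℝ E) := by
    rw [← (LinearMap.toContinuousLinearMap (𝕜 := ℝ) (E := E) (F' := ℝ)).finrank_eq]
    exact (Subspace.dual_finrank_eq (K := ℝ) (V := E)).symm
  exact ⟨hinj, (LinearMap.injective_iff_surjective_of_finrank_eq_finrank hfin).1 hinj⟩

lemma IsPosDef.exists_equiv {A : Op E} (hA : IsPosDef A) :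
    ∃ e : E ≃L[ℝ] StrongDual ℝ E, (e : Op E) = A :=
  ⟨(LinearEquiv.ofBijective (A : E →ₗ[ℝ] StrongDual ℝ E) hA.bijective).toContinuousLinearEquiv, by
    ext; rfl⟩

lemma IsPosDef.apply_inverse {A : Op E} (hA : IsPosDef A) (s : StrongDual ℝ E) :
    A (A.inverse s) = s := by
  obtain ⟨e, rfl⟩ := hA.exists_equiv
  simp

lemma IsPosDef.inverse_apply {A : Op E} (hA : IsPosDef A) (x : E) : A.inverse (A x) = x := by
  obtain ⟨e, rfl⟩ := hA.exists_equiv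
  simp

lemma IsPosDef.inverse_symm {A : Op E} (hA : IsPosDef A) (s t : StrongDual ℝ E) :
    s (A.inverse t) = t (A.inverse s) := by
  conv_lhs => rw [← hA.apply_inverse s]
  conv_rhs => rw [← hA.apply_inverse t]
  rw [hA.symm]

lemma IsPosDef.apply_inverse_nonneg {A : Op E} (hA : IsPosDef A) (s : StrongDual ℝ E) :
    0 ≤ s (A.inverse s) := by
  have := hA.nonneg (A.inverse s)
  rwa [hA.apply_inverse] at this

/-- Inversion reverses the order of positive definite operators. -/
lemma IsPosDef.inverse_le {A G : Op E} (hA : IsPosDef A) (hG : IsPosDef G) {c : ℝ} (hc : 0 < c)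
    (h : ∀ x, A x x ≤ c * G x x) (s : StrongDual ℝ E) :
    s (G.inverse s) ≤ c * s (A.inverse s) := by
  have h1 : G (G.inverse s) (G.inverse s) = s (G.inverse s) := by rw [hG.apply_inverse]
  have h2 : A (G.inverse s) (G.inverse s) ≤ c * s (G.inverse s) := by
    rw [← h1]; exact h _
  -- Cauchy–Schwarz for A on A⁻¹s and G⁻¹s bounds ⟨s, G⁻¹s⟩² by ⟨s, A⁻¹s⟩ · ⟨A G⁻¹s, G⁻¹s⟩; one
  -- factor ⟨s, G⁻¹s⟩ then cancels.
  have h3 := hA.cauchy_schwarz (A.inverse s) (G.inverse s)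
  rw [hA.apply_inverse] at h3
  have h4 := hG.apply_inverse_nonneg s
  have h5 := hA.apply_inverse_nonneg s
  rcases h4.eq_or_lt with h0 | h0
  · rw [← h0]; positivity
  · have h6 := h3.trans (mul_le_mul_of_nonneg_left h2 h5)
    have h7 : s (G.inverse s) * s (G.inverse s) ≤
        (c * s (A.inverse s)) * s (G.inverse s) := by linarith
    exact le_of_mul_le_mul_right h7 h0

/-- If `G` is spectrally close to `A`, then one quasi-Newton step contracts the gradient of the
quadratic with Hessian `A`. -/
lemma IsPosDef.contraction {A G : Op E} (hA : IsPosDef A) (hG : IsPosDef G) {ξ η q : ℝ}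
    (hξ : 0 < ξ) (hη : 0 < η) (hq : 0 < q) (hξq : ξ - 1 ≤ q) (hηq : 1 - 1 / η ≤ q)
    (hAG : ∀ x, A x x ≤ ξ * G x x) (hGA : ∀ x, G x x ≤ η * A x x) (g : StrongDual ℝ E) :
    (g - A (G.inverse g)) (A.inverse (g - A (G.inverse g))) ≤ q ^ 2 * g (A.inverse g) := by
  -- The spectrum of G⁻¹A lies in [1/η, ξ], so the form A − AG⁻¹A lies between −qA and qA.
  -- Polarization then extends the bound from the diagonal to pairs of vectors.
  have hbound : ∀ x, |A x x - A x (G.inverse (A x))| ≤ q * A x x := by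
    intro x
    have h1 := hA.inverse_le hG hξ hAG (A x)
    have h2 := hG.inverse_le hA hη hGA (A x)
    rw [hA.inverse_apply] at h1 h2
    have h3 := hA.nonneg x
    have h4 : 1 / η * A x x ≤ A x (G.inverse (A x)) := by
      rw [div_mul_eq_mul_div, one_mul, div_le_iff₀ hη]; linarith
    rw [abs_le]
    constructor
    · nlinarith
    · nlinarith
  have hpol : ∀ x y, 2 * (A x y - A x (G.inverse (A y))) ≤ q * (A x x + A y y) := by
    intro x y
    have h1 := (abs_le.1 (hbound (x + y))).2
    have h2 := (abs_le.1 (hbound (x - y))).1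
    simp only [map_add, map_sub, add_apply, sub_apply] at h1 h2
    rw [hG.inverse_symm (A y) (A x)] at h1 h2
    rw [hA.symm y x] at h1 h2
    linarith
  set a := A.inverse g with ha
  have hga : g = A a := (hA.apply_inverse g).symm
  set z := a - G.inverse (A a) with hz
  have hgz : g - A (G.inverse g) = A z := by rw [hz, map_sub, ← hga]
  rw [hgz, hA.inverse_apply]
  -- With z = a − G⁻¹Aa, the scaling 1/q balances the two squares and gives ‖z‖_A ≤ q‖a‖_A.
  have h1 := hpol ((1 / q) • z) a
  have h2 : A ((1 / q) • z) a - A ((1 / q) • z) (G.inverse (A a)) = 1 / q * A z z := by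
    rw [← map_sub, ← hz]; simp
  rw [h2] at h1
  simp only [map_smul, smul_apply, smul_eq_mul] at h1
  have h3 : q * (1 / q * (1 / q * A z z) + A a a) = 1 / q * A z z + q * A a a := by
    field_simp
  rw [h3] at h1
  have h4 : 1 / q * A z z ≤ q * A a a := by linarith
  rw [div_mul_eq_mul_div, one_mul, div_le_iff₀ hq] at h4
  rw [hga]
  linarith

end PosDef

/-! ### Broyden updates: order properties and the inverse -/

section Broyden

variable {E : Type*} [NormedAddCommGroup E] [NormedSpace ℝ E] {A G : Op E} {u : E}

lemma dfp_apply (A G : Op E) (u h k : E) :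
    dfp A G u h k = G h k - 1 / A u u * (G h u * A u k + A h u * G u k)
      + (G u u / A u u + 1) / A u u * (A h u * A u k) := by
  simp [dfp]
  ring

lemma bfgs_apply (A G : Op E) (u h k : E) :
    bfgs A G u h k = G h k - 1 / G u u * (G h u * G u k) + 1 / A u u * (A h u * A u k) := by
  simp [bfgs]

lemma broyd_apply {τ : ℝ} (hu : u ≠ 0) (h k : E) :
    broyd τ A G u h k =
      phi τ A G u * dfp A G u h k + (1 - phi τ A G u) * bfgs A G u h k := by
  simp [broyd, hu]

lemma broyd_zero (τ : ℝ) (A G : Op E) : broyd τ A G 0 = G := by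
  simp [broyd]

/-- DFP evaluates G on the A-orthogonal projection of h off u, and BFGS evaluates it on the
G-orthogonal one; both add the part of A along u. The order properties of the updates are read off
from these two decompositions. -/
lemma dfp_apply_self (hA : IsPosDef A) (hG : IsPosDef G) (hu : u ≠ 0) (h : E) :
    dfp A G u h h = G (h - (A u h / A u u) • u) (h - (A u h / A u u) • u)
      + (A u h) ^ 2 / A u u := by
  have := (hA.pos u hu).ne'
  rw [dfp_apply, hA.symm h u, hG.symm h u]
  simp only [map_sub, map_smul, sub_apply, smul_apply, smul_eq_mul, hG.symm h u]
  field_simp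
  ring

lemma bfgs_apply_self (hA : IsPosDef A) (hG : IsPosDef G) (hu : u ≠ 0) (h : E) :
    bfgs A G u h h = G (h - (G u h / G u u) • u) (h - (G u h / G u u) • u)
      + (A u h) ^ 2 / A u u := by
  have := (hG.pos u hu).ne'
  have := (hA.pos u hu).ne'
  rw [bfgs_apply, hA.symm h u, hG.symm h u]
  simp only [map_sub, map_smul, sub_apply, smul_apply, smul_eq_mul, hG.symm h u]
  field_simp
  ring

lemma IsPosDef.apply_eq_proj (hA : IsPosDef A) (hu : u ≠ 0) (h : E) :
    A h h = A (h - (A u h / A u u) • u) (h - (A u h / A u u) • u) + (A u h) ^ 2 / A u u := by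
  have := (hA.pos u hu).ne'
  simp only [map_sub, map_smul, sub_apply, smul_apply, smul_eq_mul, hA.symm h u]
  field_simp
  ring

/-- The projection along `u` minimizes the norm over the line `h - t u`. -/
lemma IsPosDef.proj_le (hA : IsPosDef A) (hu : u ≠ 0) (h : E) (t : ℝ) :
    A (h - (A u h / A u u) • u) (h - (A u h / A u u) • u) ≤ A (h - t • u) (h - t • u) := by
  have hpos := hA.pos u hu
  have key : A (h - t • u) (h - t • u) - A (h - (A u h / A u u) • u) (h - (A u h / A u u) • u)
      = (A u h - t * A u u) ^ 2 / A u u := by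
    simp only [map_sub, map_smul, sub_apply, smul_apply, smul_eq_mul, hA.symm h u]
    field_simp
    ring
  have : 0 ≤ (A u h - t * A u u) ^ 2 / A u u := by positivity
  linarith

/-- The G-orthogonal projection is the G-shortest vector on the line h + ℝu. It follows that an
upper bound is needed only for DFP and a lower bound only for BFGS. -/
lemma bfgs_le_dfp (hA : IsPosDef A) (hG : IsPosDef G) (hu : u ≠ 0) (h : E) :
    bfgs A G u h h ≤ dfp A G u h h := by
  rw [bfgs_apply_self hA hG hu, dfp_apply_self hA hG hu]
  have := hG.proj_le hu h (A u h / A u u)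
  linarith

lemma dfp_le (hA : IsPosDef A) (hG : IsPosDef G) (hu : u ≠ 0) {η : ℝ} (hη : 1 ≤ η)
    (h : ∀ x, G x x ≤ η * A x x) (x : E) : dfp A G u x x ≤ η * A x x := by
  rw [dfp_apply_self hA hG hu, hA.apply_eq_proj hu x]
  have h1 := h (x - (A u x / A u u) • u)
  have h2 : 0 ≤ (A u x) ^ 2 / A u u := div_nonneg (sq_nonneg _) (hA.nonneg u)
  nlinarith

/-- The A-orthogonal projection is A-shorter than the G-orthogonal one, to which the hypothesis is
applied; ξ ≥ 1 covers the part along u. -/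
lemma le_bfgs (hA : IsPosDef A) (hG : IsPosDef G) (hu : u ≠ 0) {ξ : ℝ} (hξ : 1 ≤ ξ)
    (h : ∀ x, A x x ≤ ξ * G x x) (x : E) : A x x ≤ ξ * bfgs A G u x x := by
  rw [bfgs_apply_self hA hG hu, hA.apply_eq_proj hu x]
  have h1 := h (x - (G u x / G u u) • u)
  have h2 : 0 ≤ (A u x) ^ 2 / A u u := div_nonneg (sq_nonneg _) (hA.nonneg u)
  have h3 := hA.proj_le hu x (G u x / G u u)
  nlinarith

/-- The ratio of determinants `det (G₊⁻¹ G)` for the Broyden update. -/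
noncomputable def detRatio (τ : ℝ) (A G : Op E) (u : E) : ℝ :=
  τ * (A u u / A u (G.inverse (A u))) + (1 - τ) * (G u u / A u u)

lemma phi_eq (hA : IsPosDef A) (τ : ℝ) (G : Op E) (u : E) :
    phi τ A G u = τ * (A u u / A u (G.inverse (A u))) / detRatio τ A G u := by
  rw [phi, detRatio, hA.symm (G.inverse (A u)) u]

lemma broyd_symm (hA : IsPosDef A) (hG : IsPosDef G) (τ : ℝ) (u x y : E) :
    broyd τ A G u x y = broyd τ A G u y x := by
  rcases eq_or_ne u 0 with rfl | hu
  · rw [broyd_zero, hG.symm]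
  rw [broyd_apply hu, broyd_apply hu, dfp_apply, dfp_apply, bfgs_apply, bfgs_apply,
    hA.symm y u, hG.symm y u, hG.symm x u, hG.symm x y, hA.symm x u]
  ring

variable [FiniteDimensional ℝ E]

lemma inner_inverse_pos (hA : IsPosDef A) (hG : IsPosDef G) (hu : u ≠ 0) :
    0 < A u (G.inverse (A u)) := by
  have hne : G.inverse (A u) ≠ 0 := by
    intro h0
    have h1 := hG.apply_inverse (A u)
    rw [h0, map_zero] at h1
    have h2 := hA.pos u hu
    rw [← h1] at h2
    simp at h2
  have := hG.pos _ hne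
  rwa [hG.apply_inverse] at this

lemma detRatio_pos (hA : IsPosDef A) (hG : IsPosDef G) (hu : u ≠ 0) {τ : ℝ}
    (hτ : τ ∈ Set.Icc (0 : ℝ) 1) : 0 < detRatio τ A G u := by
  have h1 : 0 < A u u / A u (G.inverse (A u)) :=
    div_pos (hA.pos u hu) (inner_inverse_pos hA hG hu)
  have h2 : 0 < G u u / A u u := div_pos (hG.pos u hu) (hA.pos u hu)
  unfold detRatio
  rcases hτ.1.eq_or_lt with h0 | h0
  · rw [← h0]; simpa using h2
  · have := mul_nonneg (sub_nonneg.2 hτ.2) h2.le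
    have := mul_pos h0 h1
    linarith

lemma phi_mem (hA : IsPosDef A) (hG : IsPosDef G) (hu : u ≠ 0) {τ : ℝ}
    (hτ : τ ∈ Set.Icc (0 : ℝ) 1) : phi τ A G u ∈ Set.Icc (0 : ℝ) 1 := by
  have hd := detRatio_pos hA hG hu hτ
  have h1 : 0 < A u u / A u (G.inverse (A u)) :=
    div_pos (hA.pos u hu) (inner_inverse_pos hA hG hu)
  have h2 : 0 < G u u / A u u := div_pos (hG.pos u hu) (hA.pos u hu)
  rw [phi_eq hA]
  constructor
  · exact div_nonneg (mul_nonneg hτ.1 h1.le) hd.le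
  · rw [div_le_one hd, detRatio]
    have := mul_nonneg (sub_nonneg.2 hτ.2) h2.le
    linarith

lemma broyd_le (hA : IsPosDef A) (hG : IsPosDef G) {τ : ℝ} (hτ : τ ∈ Set.Icc (0 : ℝ) 1)
    {η : ℝ} (hη : 1 ≤ η) (h : ∀ x, G x x ≤ η * A x x) (u x : E) :
    broyd τ A G u x x ≤ η * A x x := by
  rcases eq_or_ne u 0 with rfl | hu
  · rw [broyd_zero]; exact h x
  rw [broyd_apply hu]
  have hφ := phi_mem hA hG hu hτ
  have h1 := dfp_le hA hG hu hη h x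
  have h2 := (bfgs_le_dfp hA hG hu x).trans h1
  have h3 := mul_le_mul_of_nonneg_left h1 hφ.1
  have h4 := mul_le_mul_of_nonneg_left h2 (sub_nonneg.2 hφ.2)
  linarith

lemma le_broyd (hA : IsPosDef A) (hG : IsPosDef G) {τ : ℝ} (hτ : τ ∈ Set.Icc (0 : ℝ) 1)
    {ξ : ℝ} (hξ : 1 ≤ ξ) (h : ∀ x, A x x ≤ ξ * G x x) (u x : E) :
    A x x ≤ ξ * broyd τ A G u x x := by
  rcases eq_or_ne u 0 with rfl | hu
  · rw [broyd_zero]; exact h x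
  rw [broyd_apply hu]
  have hφ := phi_mem hA hG hu hτ
  have h1 := le_bfgs hA hG hu hξ h x
  have h2 := h1.trans (mul_le_mul_of_nonneg_left (bfgs_le_dfp hA hG hu x) (by linarith))
  have h3 := mul_le_mul_of_nonneg_left h2 hφ.1
  have h4 := mul_le_mul_of_nonneg_left h1 (sub_nonneg.2 hφ.2)
  linarith

lemma IsPosDef.broyd (hA : IsPosDef A) (hG : IsPosDef G) {τ : ℝ} (hτ : τ ∈ Set.Icc (0 : ℝ) 1)
    {ξ : ℝ} (hξ : 1 ≤ ξ) (h : ∀ x, A x x ≤ ξ * G x x) (u : E) :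
    IsPosDef (broyd τ A G u) := by
  have hξ0 : 0 < ξ := by linarith
  refine hA.of_le (broyd_symm hA hG τ u) (c := ξ⁻¹) (by positivity) fun x ↦ ?_
  rw [inv_mul_le_iff₀ hξ0]
  exact le_broyd hA hG hτ hξ h u x

/-- The inverse of the Broyden update. -/
lemma broyd_inverse_apply (hA : IsPosDef A) (hG : IsPosDef G) {τ : ℝ}
    (hτ : τ ∈ Set.Icc (0 : ℝ) 1) (hu : u ≠ 0) (hGp : IsPosDef (broyd τ A G u))
    (t : StrongDual ℝ E) :
    (broyd τ A G u).inverse t = G.inverse t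
      + ((τ / A u u + (1 - τ) * (A u (G.inverse (A u)) / A u u + 1) / A u u) * t u
          - (1 - τ) / A u u * t (G.inverse (A u))) • u
      - ((1 - τ) / A u u * t u + τ / A u (G.inverse (A u)) * t (G.inverse (A u))) •
          G.inverse (A u) := by
  set w := G.inverse (A u) with hw
  set α := G u u with hα
  set β := A u u with hβ
  set γ := A u w with hγ
  have hα0 : 0 < α := hG.pos u hu
  have hβ0 : 0 < β := hA.pos u hu
  have hγ0 : 0 < γ := inner_inverse_pos hA hG hu
  have hd := detRatio_pos hA hG hu hτ
  have hd' : detRatio τ A G u = (τ * β ^ 2 + (1 - τ) * α * γ) / (γ * β) := by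
    rw [detRatio, ← hw, ← hα, ← hβ, ← hγ]; field_simp
  have hD : 0 < τ * β ^ 2 + (1 - τ) * α * γ := by
    rw [hd'] at hd
    exact (div_pos_iff_of_pos_right (by positivity)).1 hd
  have hφ : phi τ A G u = τ * β ^ 2 / (τ * β ^ 2 + (1 - τ) * α * γ) := by
    rw [phi_eq hA, hd', ← hw, ← hβ, ← hγ]; field_simp
  -- The weight φ is what makes the inverse affine in τ. With t = G₊x, both sides differ from x by
  -- combinations of u and w = G⁻¹Au, so only the two scalar identities `e1` and `e2` remain.
  obtain ⟨x, rfl⟩ := hGp.bijective.2 t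
  rw [hGp.inverse_apply]
  have hexp : broyd τ A G u x = G x + ((-(1 - phi τ A G u) / α) * G x u
      - phi τ A G u / β * A x u) • G u + ((1 + phi τ A G u * α / β) / β * A x u
      - phi τ A G u / β * G x u) • A u := by
    ext k
    rw [broyd_apply hu, dfp_apply, bfgs_apply]
    simp only [add_apply, smul_apply, smul_eq_mul, ← hα, ← hβ]
    field_simp
    ring
  have hGw : G w = A u := by rw [hw, hG.apply_inverse]
  have h1 : broyd τ A G u x u = A x u := by
    rw [hexp]; simp only [add_apply, smul_apply, smul_eq_mul, ← hα, ← hβ]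
    field_simp
    ring
  have h2 : G x w = A x u := by rw [hG.symm, hGw, hA.symm]
  have h3 : G u w = β := by rw [hG.symm, hGw]
  have h4 : broyd τ A G u x w = A x u + ((-(1 - phi τ A G u) / α) * G x u
      - phi τ A G u / β * A x u) * β + ((1 + phi τ A G u * α / β) / β * A x u
      - phi τ A G u / β * G x u) * γ := by
    rw [hexp]; simp only [add_apply, smul_apply, smul_eq_mul, h2, h3, ← hγ]
  have h5 : G.inverse (broyd τ A G u x) = x + ((-(1 - phi τ A G u) / α) * G x u
      - phi τ A G u / β * A x u) • u + ((1 + phi τ A G u * α / β) / β * A x u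
      - phi τ A G u / β * G x u) • w := by
    rw [hexp]; simp only [map_add, map_smul, hG.inverse_apply, ← hw]
  rw [h5, h1, h4]
  have e1 : ((-(1 - phi τ A G u) / α) * G x u - phi τ A G u / β * A x u) +
      ((τ / β + (1 - τ) * (γ / β + 1) / β) * A x u
          - (1 - τ) / β * (A x u + ((-(1 - phi τ A G u) / α) * G x u
      - phi τ A G u / β * A x u) * β + ((1 + phi τ A G u * α / β) / β * A x u
      - phi τ A G u / β * G x u) * γ)) = 0 := by
    rw [hφ]
    field_simp
    ring
  have e2 : ((1 + phi τ A G u * α / β) / β * A x u - phi τ A G u / β * G x u) -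
      ((1 - τ) / β * A x u + τ / γ * (A x u + ((-(1 - phi τ A G u) / α) * G x u
      - phi τ A G u / β * A x u) * β + ((1 + phi τ A G u * α / β) / β * A x u
      - phi τ A G u / β * G x u) * γ)) = 0 := by
    rw [hφ]
    field_simp
    ring
  rw [← sub_eq_zero]
  rw [← neg_eq_zero]
  calc _ = ((((-(1 - phi τ A G u) / α) * G x u - phi τ A G u / β * A x u) +
      ((τ / β + (1 - τ) * (γ / β + 1) / β) * A x u
          - (1 - τ) / β * (A x u + ((-(1 - phi τ A G u) / α) * G x u
      - phi τ A G u / β * A x u) * β + ((1 + phi τ A G u * α / β) / β * A x u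
      - phi τ A G u / β * G x u) * γ)))) • u + (((1 + phi τ A G u * α / β) / β * A x u
      - phi τ A G u / β * G x u) -
      ((1 - τ) / β * A x u + τ / γ * (A x u + ((-(1 - phi τ A G u) / α) * G x u
      - phi τ A G u / β * A x u) * β + ((1 + phi τ A G u * α / β) / β * A x u
      - phi τ A G u / β * G x u) * γ))) • w := by module
    _ = 0 := by rw [e1, e2]; simp

end Broyden

/-! ### Traces and determinants of G⁻¹A -/

section TraceDet

/-- Every positive definite symmetric bilinear form has an orthonormal basis. -/
lemma exists_orthonormal_basis_of_posDef {V : Type*} [AddCommGroup V] [Module ℝ V]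
    [FiniteDimensional ℝ V] (g : V →ₗ[ℝ] V →ₗ[ℝ] ℝ) (hs : ∀ x y, g x y = g y x)
    (hp : ∀ x, x ≠ 0 → 0 < g x x) :
    ∃ b : Module.Basis (Fin (Module.finrank ℝ V)) ℝ V,
      ∀ i j, g (b i) (b j) = if i = j then 1 else 0 := by
  have hp0 : ∀ x, 0 ≤ g x x := fun x ↦ by
    rcases eq_or_ne x 0 with rfl | hx
    · simp
    · exact (hp x hx).le
  let core : InnerProductSpace.Core ℝ V :=
    { inner := fun x y ↦ g x y
      conj_inner_symm := fun x y ↦ by simpa using hs y x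
      re_inner_nonneg := fun x ↦ by simpa using hp0 x
      add_left := fun x y z ↦ by simp
      smul_left := fun x y r ↦ by simp
      definite := fun x hx ↦ by
        by_contra hne
        exact (hp x hne).ne' hx }
  let _ : NormedAddCommGroup V := core.toNormedAddCommGroup
  let _ : InnerProductSpace ℝ V := InnerProductSpace.ofCore core.toCore
  let b := stdOrthonormalBasis ℝ V
  refine ⟨b.toBasis, fun i j ↦ ?_⟩
  have h := orthonormal_iff_ite.1 b.orthonormal i j
  simpa using! h

variable {E : Type*} [NormedAddCommGroup E] [NormedSpace ℝ E] [FiniteDimensional ℝ E]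

lemma IsPosDef.exists_basis {G : Op E} (hG : IsPosDef G) :
    ∃ b : Module.Basis (Fin (Module.finrank ℝ E)) ℝ E,
      ∀ i j, G (b i) (b j) = if i = j then 1 else 0 :=
  exists_orthonormal_basis_of_posDef (V := E)
    ((ContinuousLinearMap.coeLM ℝ : (E →L[ℝ] ℝ) →ₗ[ℝ] (E →ₗ[ℝ] ℝ)) ∘ₗ (G : E →ₗ[ℝ] E →L[ℝ] ℝ))
    hG.symm hG.pos

/-- The endomorphism `G⁻¹ A`. -/
noncomputable def relEnd (G A : Op E) : E →ₗ[ℝ] E :=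
  (G.inverse : StrongDual ℝ E →ₗ[ℝ] E) ∘ₗ (A : E →ₗ[ℝ] StrongDual ℝ E)

omit [FiniteDimensional ℝ E] in
lemma relEnd_apply (G A : Op E) (x : E) : relEnd G A x = G.inverse (A x) := rfl

/-- The trace of `G⁻¹ A`. -/
noncomputable def relTrace (G A : Op E) : ℝ := LinearMap.trace ℝ E (relEnd G A)

/-- The determinant of `G⁻¹ A`. -/
noncomputable def relDet (G A : Op E) : ℝ := LinearMap.det (relEnd G A)

/-- In a G-orthonormal basis G⁻¹A becomes the Gram matrix of A. It is therefore symmetric, and its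
trace, determinant and eigenvalues are available from matrix theory. -/
lemma toMatrix_relEnd {G : Op E} (hG : IsPosDef G) (A : Op E)
    {b : Module.Basis (Fin (Module.finrank ℝ E)) ℝ E}
    (hb : ∀ i j, G (b i) (b j) = if i = j then 1 else 0) (i j) :
    LinearMap.toMatrix b b (relEnd G A) i j = A (b j) (b i) := by
  rw [LinearMap.toMatrix_apply, relEnd_apply]
  have h : ∀ x, b.repr x i = G x (b i) := by
    intro x
    conv_rhs => rw [← b.sum_repr x]
    simp only [map_sum, map_smul, sum_apply, smul_apply, hb]
    simp
  rw [h, hG.apply_inverse]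

omit [FiniteDimensional ℝ E] in
lemma relTrace_sub (G A₁ A₂ : Op E) : relTrace G (A₁ - A₂) = relTrace G A₁ - relTrace G A₂ := by
  rw [relTrace, relTrace, relTrace, ← map_sub]
  congr 1
  ext x
  simp [relEnd_apply]

omit [FiniteDimensional ℝ E] in
lemma relTrace_smul (G A : Op E) (c : ℝ) : relTrace G (c • A) = c * relTrace G A := by
  rw [relTrace, relTrace, ← smul_eq_mul, ← map_smul]
  congr 1
  ext x
  simp [relEnd_apply]

lemma relEnd_self {G : Op E} (hG : IsPosDef G) : relEnd G G = LinearMap.id := by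
  ext x
  exact hG.inverse_apply x

lemma relTrace_self {G : Op E} (hG : IsPosDef G) : relTrace G G = Module.finrank ℝ E := by
  rw [relTrace, relEnd_self hG, LinearMap.trace_id]

lemma relDet_self {G : Op E} (hG : IsPosDef G) : relDet G G = 1 := by
  rw [relDet, relEnd_self hG, LinearMap.det_id]

lemma relDet_mul {G A : Op E} (hA : IsPosDef A) (C : Op E) :
    relDet G A * relDet A C = relDet G C := by
  rw [relDet, relDet, relDet, ← LinearMap.det_comp]
  congr 1
  ext x
  simp [relEnd_apply, hA.apply_inverse]

lemma relTrace_nonneg {G : Op E} (hG : IsPosDef G) {A : Op E} (hA : ∀ x, 0 ≤ A x x) :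
    0 ≤ relTrace G A := by
  obtain ⟨b, hb⟩ := hG.exists_basis
  rw [relTrace, LinearMap.trace_eq_matrix_trace ℝ b, Matrix.trace]
  refine Finset.sum_nonneg fun i _ ↦ ?_
  rw [Matrix.diag_apply, toMatrix_relEnd hG A hb]
  exact hA _

lemma relTrace_mono {G : Op E} (hG : IsPosDef G) {A₁ A₂ : Op E} (h : ∀ x, A₁ x x ≤ A₂ x x) :
    relTrace G A₁ ≤ relTrace G A₂ := by
  have := relTrace_nonneg hG (A := A₂ - A₁) fun x ↦ by simpa using h x
  rw [relTrace_sub] at this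
  linarith

lemma posDef_toMatrix_relEnd {G A : Op E} (hG : IsPosDef G) (hA : IsPosDef A)
    {b : Module.Basis (Fin (Module.finrank ℝ E)) ℝ E}
    (hb : ∀ i j, G (b i) (b j) = if i = j then 1 else 0) :
    (LinearMap.toMatrix b b (relEnd G A)).PosDef := by
  refine Matrix.PosDef.of_dotProduct_mulVec_pos ?_ fun x hx ↦ ?_
  · ext i j
    simp [toMatrix_relEnd hG A hb, hA.symm (b i)]
  · have hne : b.equivFun.symm x ≠ 0 := b.equivFun.symm.map_ne_zero_iff.2 hx
    have h : star x ⬝ᵥ (LinearMap.toMatrix b b (relEnd G A)).mulVec x =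
        A (b.equivFun.symm x) (b.equivFun.symm x) := by
      simp only [dotProduct, Matrix.mulVec, toMatrix_relEnd hG A hb, star_trivial,
        Module.Basis.equivFun_symm_apply, map_sum, map_smul, sum_apply,
        smul_apply, smul_eq_mul, Finset.mul_sum]
      refine Finset.sum_congr rfl fun i _ ↦ Finset.sum_congr rfl fun j _ ↦ ?_
      ring
    rw [h]
    exact hA.pos _ hne

lemma relDet_pos {G A : Op E} (hG : IsPosDef G) (hA : IsPosDef A) : 0 < relDet G A := by
  obtain ⟨b, hb⟩ := hG.exists_basis
  rw [relDet, ← LinearMap.det_toMatrix b]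
  exact (posDef_toMatrix_relEnd hG hA hb).det_pos

/-- `ln det (G⁻¹ A) ≤ tr (G⁻¹ A) - n`. -/
lemma log_relDet_le {G A : Op E} (hG : IsPosDef G) (hA : IsPosDef A) :
    Real.log (relDet G A) ≤ relTrace G A - Module.finrank ℝ E := by
  obtain ⟨b, hb⟩ := hG.exists_basis
  have hM := posDef_toMatrix_relEnd hG hA hb
  rw [relDet, relTrace, ← LinearMap.det_toMatrix b, LinearMap.trace_eq_matrix_trace ℝ b,
    hM.isHermitian.det_eq_prod_eigenvalues, hM.isHermitian.trace_eq_sum_eigenvalues]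
  simp only [RCLike.ofReal_real_eq_id, id_eq]
  rw [Real.log_prod (fun i _ ↦ (hM.eigenvalues_pos i).ne')]
  have h : ∀ i, Real.log (hM.isHermitian.eigenvalues i) ≤ hM.isHermitian.eigenvalues i - 1 :=
    fun i ↦ Real.log_le_sub_one_of_pos (hM.eigenvalues_pos i)
  calc _ ≤ ∑ i, (hM.isHermitian.eigenvalues i - 1) := Finset.sum_le_sum fun i _ ↦ h i
    _ = _ := by simp

/-- If `A ⪯ c G`, then `ln det (G⁻¹ A) ≤ n ln c`. -/
lemma log_relDet_le_of_le {G A : Op E} (hG : IsPosDef G) (hA : IsPosDef A) {c : ℝ} (hc : 0 < c)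
    (h : ∀ x, A x x ≤ c * G x x) :
    Real.log (relDet G A) ≤ Module.finrank ℝ E * Real.log c := by
  -- Rescaling by c brings A below G, so the trace is at most n and the previous bound gives a
  -- nonpositive log-determinant.
  have hA' : IsPosDef (c⁻¹ • A) := hA.smul (by positivity)
  have h1 := log_relDet_le hG hA'
  have h2 : relTrace G (c⁻¹ • A) ≤ relTrace G G := by
    refine relTrace_mono hG fun x ↦ ?_
    simp only [smul_apply, smul_eq_mul]
    rw [inv_mul_le_iff₀ hc]
    exact h x
  rw [relTrace_self hG] at h2
  have h3 : relDet G (c⁻¹ • A) = c⁻¹ ^ Module.finrank ℝ E * relDet G A := by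
    rw [relDet, relDet, ← LinearMap.det_smul]
    congr 1
    ext x
    simp [relEnd_apply]
  rw [h3, Real.log_mul (by positivity) (relDet_pos hG hA).ne', Real.log_pow, Real.log_inv] at h1
  linarith

/-- The determinant of a rank-two perturbation of the identity. -/
lemma det_id_add_smulRight_add_smulRight {V : Type*} [AddCommGroup V] [Module ℝ V]
    [FiniteDimensional ℝ V] (s t : V →ₗ[ℝ] ℝ) (x y : V) :
    LinearMap.det (LinearMap.id + s.smulRight x + t.smulRight y) =
      (1 + s x) * (1 + t y) - s y * t x := by
  let b := Module.finBasis ℝ V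
  let U : Matrix (Fin (Module.finrank ℝ V)) (Fin 2) ℝ :=
    Matrix.of fun i j ↦ b.repr (![x, y] j) i
  let W : Matrix (Fin 2) (Fin (Module.finrank ℝ V)) ℝ := Matrix.of fun i j ↦ (![s, t] i) (b j)
  have h1 : LinearMap.toMatrix b b (LinearMap.id + s.smulRight x + t.smulRight y) =
      1 + U * W := by
    rw [map_add, map_add, LinearMap.toMatrix_id, add_assoc]
    congr 1
    ext i j
    simp [Matrix.vecMulVec_apply, U, W, Matrix.mul_apply, Fin.sum_univ_two, mul_comm]
  have h2 : ∀ i j, (W * U) i j = (![s, t] i) (![x, y] j) := by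
    intro i j
    conv_rhs => rw [← b.sum_repr (![x, y] j)]
    rw [map_sum]
    simp [-Module.Basis.sum_repr, U, W, Matrix.mul_apply, mul_comm]
  -- The identity det(1 + UW) = det(1 + WU) reduces the determinant to a 2 × 2 one.
  rw [← LinearMap.det_toMatrix b, h1, Matrix.det_one_add_mul_comm, Matrix.det_fin_two]
  simp [h2]

variable {A G : Op E} {u : E}

lemma relTrace_broyd (hA : IsPosDef A) (hG : IsPosDef G) {τ : ℝ}
    (hτ : τ ∈ Set.Icc (0 : ℝ) 1) (hu : u ≠ 0) (hGp : IsPosDef (broyd τ A G u)) :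
    relTrace G A - relTrace (broyd τ A G u) A =
      τ * (A (G.inverse (A u)) (G.inverse (A u)) / A u (G.inverse (A u)))
        + (1 - τ) * (A u (G.inverse (A u)) / A u u) - 1 := by
  have hβ0 : 0 < A u u := hA.pos u hu
  have hγ0 : 0 < A u (G.inverse (A u)) := inner_inverse_pos hA hG hu
  set w := G.inverse (A u) with hw
  have h : relEnd (broyd τ A G u) A = relEnd G A
      + ((τ / A u u + (1 - τ) * (A u w / A u u + 1) / A u u) • (A u : E →ₗ[ℝ] ℝ)
          - ((1 - τ) / A u u) • (A w : E →ₗ[ℝ] ℝ)).smulRight u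
      - (((1 - τ) / A u u) • (A u : E →ₗ[ℝ] ℝ)
          + (τ / A u w) • (A w : E →ₗ[ℝ] ℝ)).smulRight w := by
    ext x
    rw [relEnd_apply, broyd_inverse_apply hA hG hτ hu hGp]
    simp [relEnd_apply, ← hw, hA.symm x]
  rw [relTrace, relTrace, h, map_sub, map_add, LinearMap.trace_smulRight,
    LinearMap.trace_smulRight]
  simp only [LinearMap.sub_apply, LinearMap.add_apply, LinearMap.smul_apply, smul_eq_mul,
    ContinuousLinearMap.coe_coe, hA.symm w u]
  field_simp
  ring

lemma relDet_broyd (hA : IsPosDef A) (hG : IsPosDef G) {τ : ℝ}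
    (hτ : τ ∈ Set.Icc (0 : ℝ) 1) (hu : u ≠ 0) (hGp : IsPosDef (broyd τ A G u)) :
    relDet (broyd τ A G u) G = detRatio τ A G u := by
  have hα0 : 0 < G u u := hG.pos u hu
  have hβ0 : 0 < A u u := hA.pos u hu
  have hγ0 : 0 < A u (G.inverse (A u)) := inner_inverse_pos hA hG hu
  have hGw : G (G.inverse (A u)) = A u := hG.apply_inverse _
  rw [detRatio]
  set w := G.inverse (A u) with hw
  have h : relEnd (broyd τ A G u) G = LinearMap.id
      + ((τ / A u u + (1 - τ) * (A u w / A u u + 1) / A u u) • (G u : E →ₗ[ℝ] ℝ)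
          - ((1 - τ) / A u u) • (A u : E →ₗ[ℝ] ℝ)).smulRight u
      + (-((1 - τ) / A u u) • (G u : E →ₗ[ℝ] ℝ)
          - (τ / A u w) • (A u : E →ₗ[ℝ] ℝ)).smulRight w := by
    ext x
    rw [relEnd_apply, broyd_inverse_apply hA hG hτ hu hGp, hG.inverse_apply, ← hw]
    simp only [hG.symm x w, hG.symm x u, hGw, LinearMap.add_apply, LinearMap.smulRight_apply,
      LinearMap.sub_apply, LinearMap.smul_apply, smul_eq_mul, ContinuousLinearMap.coe_coe,
      LinearMap.id_apply]
    module
  rw [relDet, h, det_id_add_smulRight_add_smulRight]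
  simp only [LinearMap.sub_apply, LinearMap.smul_apply, smul_eq_mul,
    ContinuousLinearMap.coe_coe, hG.symm u w, hGw]
  field_simp
  ring

end TraceDet

/-! ### Scalar inequalities -/

section Scalar

/-- The difference of the two sides vanishes at 1, and its derivative has the sign of (t − 1)(13t² −
19t + 7). The quadratic has discriminant −3; the constant 6/13 lies just below 2√3 − 3, where the
discriminant would vanish. -/
lemma log_sq_sub_le {t : ℝ} (ht : 0 < t) :
    6 / 13 * Real.log (t + 1 / t - 1) ≤ t - 1 - Real.log t := by
  have hq : ∀ x : ℝ, 0 < x ^ 2 - x + 1 := fun x ↦ by nlinarith [sq_nonneg (x - 1 / 2)]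
  let g : ℝ → ℝ := fun x ↦ x - 1 - 7 / 13 * Real.log x - 6 / 13 * Real.log (x ^ 2 - x + 1)
  have hder : ∀ x, 0 < x → HasDerivAt g
      ((x - 1) * (13 * x ^ 2 - 19 * x + 7) / (13 * x * (x ^ 2 - x + 1))) x := by
    intro x hx
    have h1 := (Real.hasDerivAt_log hx.ne').const_mul (7 / 13 : ℝ)
    have h2 : HasDerivAt (fun x : ℝ ↦ x ^ 2 - x + 1) (2 * x - 1) x := by
      simpa using (((hasDerivAt_id x).pow 2).sub (hasDerivAt_id x)).add_const (1 : ℝ)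
    have h3 := (h2.log (hq x).ne').const_mul (6 / 13 : ℝ)
    have h4 := ((((hasDerivAt_id x).sub_const (1 : ℝ)).sub h1).sub h3)
    refine h4.congr_deriv ?_
    have := (hq x).ne'
    generalize hQ : x ^ 2 - x + 1 = Q at this ⊢
    field_simp
    rw [← hQ]
    ring
  have hq2 : ∀ x : ℝ, 0 < 13 * x ^ 2 - 19 * x + 7 := fun x ↦ by
    nlinarith [sq_nonneg (x - 19 / 26)]
  have hg1 : g 1 = 0 := by simp [g]
  have hg : 0 ≤ g t := by
    rw [← hg1]
    rcases le_total t 1 with h1 | h1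
    · refine antitoneOn_of_deriv_nonpos (convex_Icc t 1) ?_ ?_ ?_ ⟨le_rfl, h1⟩ ⟨h1, le_rfl⟩ h1
      · exact fun x hx ↦ (hder x (ht.trans_le hx.1)).continuousAt.continuousWithinAt
      · rw [interior_Icc]
        exact fun x hx ↦ (hder x (ht.trans hx.1)).differentiableAt.differentiableWithinAt
      · rw [interior_Icc]
        intro x hx
        have hx0 := ht.trans hx.1
        rw [(hder x hx0).deriv]
        refine div_nonpos_of_nonpos_of_nonneg ?_ (by have := hq x; positivity)
        exact mul_nonpos_of_nonpos_of_nonneg (by linarith [hx.2]) (hq2 x).le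
    · refine monotoneOn_of_deriv_nonneg (convex_Icc 1 t) ?_ ?_ ?_ ⟨le_rfl, h1⟩ ⟨h1, le_rfl⟩ h1
      · exact fun x hx ↦
          (hder x (one_pos.trans_le hx.1)).continuousAt.continuousWithinAt
      · rw [interior_Icc]
        exact fun x hx ↦
          (hder x (one_pos.trans hx.1)).differentiableAt.differentiableWithinAt
      · rw [interior_Icc]
        intro x hx
        have hx0 : 0 < x := one_pos.trans hx.1
        rw [(hder x hx0).deriv]
        refine div_nonneg ?_ (by have := hq x; positivity)
        exact mul_nonneg (by linarith [hx.1]) (hq2 x).le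
  have hlog : Real.log (t + 1 / t - 1) = Real.log (t ^ 2 - t + 1) - Real.log t := by
    rw [← Real.log_div (hq t).ne' ht.ne']
    congr 1
    field_simp
    ring
  rw [hlog]
  simp only [g] at hg
  linarith

/-- The scalar inequality that bounds the decrease of the potential from below. -/
lemma log_add_sub_one_le {a r : ℝ} (hr : 0 < r) (har : 1 ≤ a * r) :
    6 / 13 * Real.log (a + r - 1) ≤ a - 1 + Real.log r := by
  have hra : 1 / r ≤ a := by rwa [div_le_iff₀ hr]
  set t := 1 / r with ht
  have ht0 : 0 < t := by positivity
  have hrt : r = 1 / t := by rw [ht, one_div_one_div]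
  have hy : 1 ≤ t + 1 / t - 1 := by
    have : t + 1 / t - 1 - 1 = (t - 1) ^ 2 / t := by field_simp; ring
    have : 0 ≤ (t - 1) ^ 2 / t := by positivity
    linarith
  have h1 := log_sq_sub_le ht0
  rw [hrt, Real.log_div one_ne_zero ht0.ne', Real.log_one]
  set y := t + 1 / t - 1 with hydef
  have hx : a + 1 / t - 1 = y + (a - t) := by rw [hydef]; ring
  -- The logarithm is 1-Lipschitz on [1, ∞), so the excess of a over 1/r is paid for by the linear
  -- term.
  have h2 : Real.log (y + (a - t)) ≤ Real.log y + (a - t) := by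
    have hpos : 0 < y + (a - t) := by linarith
    have h3 := Real.log_le_sub_one_of_pos (x := (y + (a - t)) / y) (by positivity)
    rw [Real.log_div hpos.ne' (by positivity)] at h3
    have h4 : (y + (a - t)) / y - 1 ≤ a - t := by
      rw [sub_le_iff_le_add, div_le_iff₀ (by linarith)]
      nlinarith
    linarith
  rw [hx]
  linarith

/-- Here b = ⟨AG⁻¹Au, u⟩/⟨Au, u⟩ and c = ⟨Au, u⟩/⟨Gu, u⟩, so c ≤ b is Cauchy–Schwarz and b ≤ 3/2
comes from A ⪯ (3/2)G. The left side is the BFGS residual divided by ⟨Gu, u⟩; `dfp_ratio_le` is the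
DFP counterpart. -/
lemma bfgs_ratio_le {b c : ℝ} (hc : 0 < c) (hcb : c ≤ b) (hb : b ≤ 3 / 2) :
    (b + 1) / c + c - 3 ≤ 5 / 2 * (b - 2 + 1 / c) := by
  have hb0 : 0 < b := hc.trans_le hcb
  have h : 5 / 2 * (b - 2 + 1 / c) - ((b + 1) / c + c - 3) =
      ((b - c) * (3 / 2 - b) + 3 / 2 * c * (1 - b) ^ 2 + b * c * (b - c)) / (b * c) := by
    field_simp
    ring
  have h1 := mul_nonneg (sub_nonneg.2 hcb) (sub_nonneg.2 hb)
  have h2 := mul_nonneg (mul_pos hb0 hc).le (sub_nonneg.2 hcb)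
  have : 0 ≤ ((b - c) * (3 / 2 - b) + 3 / 2 * c * (1 - b) ^ 2 + b * c * (b - c)) / (b * c) := by
    positivity
  linarith

lemma dfp_ratio_le {b c : ℝ} (hc : 0 < c) (hcb : c ≤ b) (hb : b ≤ 3 / 2) :
    c - c / b + 1 / c - 1 ≤ 5 / 2 * (b - 2 + 1 / c) := by
  have hb0 : 0 < b := hc.trans_le hcb
  have h : 5 / 2 * (b - 2 + 1 / c) - (c - c / b + 1 / c - 1) =
      (3 / 2 * b * (1 - b) ^ 2 + (b - c) * (3 * b - 3 / 2 * b ^ 2 - c + b * c)) / (b * c) := by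
    field_simp
    ring
  have h1 : 0 ≤ 3 * b - 3 / 2 * b ^ 2 - c + b * c := by
    rcases le_total 1 b with h | h
    · nlinarith
    · nlinarith
  have h2 := mul_nonneg (sub_nonneg.2 hcb) h1
  have : 0 ≤ (3 / 2 * b * (1 - b) ^ 2 + (b - c) * (3 * b - 3 / 2 * b ^ 2 - c + b * c))
      / (b * c) := by
    positivity
  linarith

end Scalar

/-! ### One update: potential decrease against residual -/

section Step

variable {E : Type*} [NormedAddCommGroup E] [NormedSpace ℝ E] [FiniteDimensional ℝ E]
  {A G : Op E} {u : E}

omit [FiniteDimensional ℝ E] in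
lemma broyd_secant (hA : IsPosDef A) (hG : IsPosDef G) (τ : ℝ) (u : E) (hu : u ≠ 0) :
    broyd τ A G u u = A u := by
  have h1 := (hA.pos u hu).ne'
  have h2 := (hG.pos u hu).ne'
  ext k
  rw [broyd_apply hu, dfp_apply, bfgs_apply]
  field_simp
  ring

/-- The secant equation gives G₊⁻¹Au = u, so the inverse formula is needed only for ⟨Gu, G₊⁻¹Gu⟩. -/
lemma broyd_residual (hA : IsPosDef A) (hG : IsPosDef G) {τ : ℝ}
    (hτ : τ ∈ Set.Icc (0 : ℝ) 1) (hu : u ≠ 0) (hGp : IsPosDef (broyd τ A G u)) :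
    (A u - G u) ((broyd τ A G u).inverse (A u - G u)) =
      τ * (A u u - G u u + G u u ^ 2 / A u u - A u u ^ 2 / A u (G.inverse (A u)))
      + (1 - τ) * (A u u - 3 * G u u + (A u (G.inverse (A u)) / A u u + 1) * G u u ^ 2 / A u u) := by
  have hα0 : 0 < G u u := hG.pos u hu
  have hβ0 : 0 < A u u := hA.pos u hu
  have hγ0 : 0 < A u (G.inverse (A u)) := inner_inverse_pos hA hG hu
  have hN : (broyd τ A G u).inverse (A u) = u := by
    conv_lhs => rw [← broyd_secant hA hG τ u hu]
    exact hGp.inverse_apply u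
  have h1 : A u ((broyd τ A G u).inverse (G u)) = G u u := by
    rw [hGp.inverse_symm, hN]
  have hw : G u (G.inverse (A u)) = A u u := by rw [hG.symm, hG.apply_inverse]
  have h2 : G u ((broyd τ A G u).inverse (G u)) = G u u +
      ((τ / A u u + (1 - τ) * (A u (G.inverse (A u)) / A u u + 1) / A u u) * G u u
        - (1 - τ) / A u u * A u u) * G u u
      - ((1 - τ) / A u u * G u u + τ / A u (G.inverse (A u)) * A u u) * A u u := by
    rw [broyd_inverse_apply hA hG hτ hu hGp, hG.inverse_apply, hw]
    simp only [map_sub, map_add, map_smul, smul_eq_mul, hw]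
  rw [map_sub, hN]
  simp only [map_sub, sub_apply, h1, h2]
  field_simp
  ring

/-- One Broyden update: the decrease of the potential controls the residual of the secant
approximation. -/
lemma broyd_step (hA : IsPosDef A) (hG : IsPosDef G) {τ : ℝ}
    (hτ : τ ∈ Set.Icc (0 : ℝ) 1) {η : ℝ} (hη : 1 ≤ η)
    (hAG : ∀ x, A x x ≤ 3 / 2 * G x x) (hGA : ∀ x, G x x ≤ η * A x x) (u : E) :
    ∃ ρ : ℝ, 0 ≤ ρ ∧
      6 / 13 * Real.log (1 + (τ * (2 / (3 * η)) + 1 - τ) * ρ) ≤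
        relTrace G A - relTrace (broyd τ A G u) A + Real.log (relDet (broyd τ A G u) G) ∧
      (A u - G u) ((broyd τ A G u).inverse (A u - G u)) ≤ 5 / 2 * ρ * G u u := by
  have hGp : IsPosDef (broyd τ A G u) := hA.broyd hG hτ (by norm_num) hAG u
  rcases eq_or_ne u 0 with rfl | hu
  · exact ⟨0, le_rfl, by simp [broyd_zero, relDet_self hG], by simp⟩
  have hα0 : 0 < G u u := hG.pos u hu
  have hβ0 : 0 < A u u := hA.pos u hu
  have hγ0 : 0 < A u (G.inverse (A u)) := inner_inverse_pos hA hG hu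
  have hres := broyd_residual hA hG hτ hu hGp
  have htr := relTrace_broyd hA hG hτ hu hGp
  have hdet := relDet_broyd hA hG hτ hu hGp
  have hd := detRatio_pos hA hG hu hτ
  have hGw : G (G.inverse (A u)) = A u := hG.apply_inverse _
  have hγξ : A u (G.inverse (A u)) ≤ 3 / 2 * A u u := by
    have := hA.inverse_le hG (by norm_num) hAG (A u)
    rwa [hA.inverse_apply] at this
  rw [detRatio] at hdet hd
  set w := G.inverse (A u) with hw
  have hcs1 : A u u ^ 2 ≤ A u w * G u u := by
    have := hG.cauchy_schwarz w u
    rwa [hGw] at this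
  have hcs2 := hA.cauchy_schwarz u w
  have hsub : G (w - u) (w - u) = A u w - 2 * A u u + G u u := by
    simp only [map_sub, sub_apply, hGw, hG.symm u w]
    ring
  have hsub' : A (w - u) (w - u) = A w w - 2 * A u w + A u u := by
    simp only [map_sub, sub_apply, hA.symm w u]
    ring
  have hρG : 0 ≤ G (w - u) (w - u) := hG.nonneg _
  have hGA' := hGA (w - u)
  rw [hsub] at hρG hGA'
  rw [hsub'] at hGA'
  rw [htr, hdet, hres]
  generalize A w w = δ at *
  generalize A u w = γ at *
  generalize A u u = β at *
  generalize G u u = α at *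
  obtain ⟨hτ0, hτ1⟩ := hτ
  have hτ1' := sub_nonneg.2 hτ1
  have hρ : γ / β - 2 + α / β = (γ - 2 * β + α) / β := by field_simp
  have hρ0 : 0 ≤ γ / β - 2 + α / β := by rw [hρ]; positivity
  -- This ρ equals ‖w − u‖²_G/⟨Au, u⟩ with w = G⁻¹Au, that is, the squared secant error (A − G)u in
  -- the G⁻¹-norm, relative to ⟨Au, u⟩.
  refine ⟨γ / β - 2 + α / β, hρ0, ?_, ?_⟩
  · have hb_a : γ / β ≤ δ / γ := by
      rw [div_le_div_iff₀ hβ0 hγ0]; linarith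
    have hc_b : β / γ ≤ α / β := by
      rw [div_le_div_iff₀ hγ0 hβ0]; linarith
    -- The DFP part of the decrease involves ‖w − u‖²_A/γ instead of ρ. Passing from G to A costs η,
    -- and γ ≤ (3/2)β costs 3/2.
    have h1 : 2 / (3 * η) * (γ / β - 2 + α / β) ≤ δ / γ - 2 + β / γ := by
      have e1 : δ / γ - 2 + β / γ = (δ - 2 * γ + β) / γ := by field_simp
      rw [hρ, e1, div_mul_div_comm, div_le_div_iff₀ (by positivity) hγ0]
      have hδ : 0 ≤ δ - 2 * γ + β := by
        by_contra hneg
        push Not at hneg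
        nlinarith
      have h2 := mul_le_mul_of_nonneg_right hGA' hγ0.le
      have h3 := mul_le_mul_of_nonneg_left hγξ (mul_nonneg (by linarith : 0 ≤ η) hδ)
      linarith
    have h2 := log_add_sub_one_le (a := τ * (δ / γ) + (1 - τ) * (γ / β)) hd ?_
    · have h3 : Real.log (1 + (τ * (2 / (3 * η)) + 1 - τ) * (γ / β - 2 + α / β)) ≤
          Real.log (τ * (δ / γ) + (1 - τ) * (γ / β) + (τ * (β / γ) + (1 - τ) * (α / β)) - 1) := by
        refine Real.log_le_log ?_ ?_
        · have : 0 ≤ τ * (2 / (3 * η)) + 1 - τ := by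
            have : 0 ≤ τ * (2 / (3 * η)) := mul_nonneg hτ0 (by positivity)
            linarith
          have := mul_nonneg this hρ0
          linarith
        · have := mul_le_mul_of_nonneg_left h1 hτ0
          linarith
      linarith
    · have e1 : γ / β ≤ τ * (δ / γ) + (1 - τ) * (γ / β) := by
        linarith [mul_le_mul_of_nonneg_left hb_a hτ0]
      have e2 : β / γ ≤ τ * (β / γ) + (1 - τ) * (α / β) := by
        linarith [mul_le_mul_of_nonneg_left hc_b hτ1']
      calc (1 : ℝ) = γ / β * (β / γ) := by field_simp
        _ ≤ _ := mul_le_mul e1 e2 (by positivity) ((by positivity : 0 ≤ γ / β).trans e1)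
  · have hc0 : 0 < β / α := by positivity
    have hcb : β / α ≤ γ / β := by
      rw [div_le_div_iff₀ hα0 hβ0]; linarith
    have hb : γ / β ≤ 3 / 2 := by rwa [div_le_iff₀ hβ0]
    have h1 := mul_le_mul_of_nonneg_left (dfp_ratio_le hc0 hcb hb) (mul_nonneg hτ0 hα0.le)
    have h2 := mul_le_mul_of_nonneg_left (bfgs_ratio_le hc0 hcb hb) (mul_nonneg hτ1' hα0.le)
    have e1 : τ * α * (β / α - β / α / (γ / β) + 1 / (β / α) - 1) =
        τ * (β - α + α ^ 2 / β - β ^ 2 / γ) := by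
      field_simp
      ring
    have e2 : (1 - τ) * α * ((γ / β + 1) / (β / α) + β / α - 3) =
        (1 - τ) * (β - 3 * α + (γ / β + 1) * α ^ 2 / β) := by
      field_simp
      ring
    rw [e1] at h1
    rw [e2] at h2
    rw [one_div_div] at h1 h2
    linarith

end Step

/-! ### Integral Hessians and strong self-concordance -/

section Hessian

variable {E : Type*} [NormedAddCommGroup E] [NormedSpace ℝ E] {f : E → ℝ}

lemma contDiff_grad (hf : ContDiff ℝ 2 f) : ContDiff ℝ 1 (grad f) :=
  hf.fderiv_right (m := 1) (by norm_num)

lemma hasFDerivAt_grad (hf : ContDiff ℝ 2 f) (x : E) : HasFDerivAt (grad f) (hess f x) x :=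
  ((contDiff_grad hf).differentiable (by norm_num) x).hasFDerivAt

lemma continuous_hess (hf : ContDiff ℝ 2 f) : Continuous (hess f) :=
  (contDiff_grad hf).continuous_fderiv (by norm_num)

lemma hess_symm (hf : ContDiff ℝ 2 f) (x h k : E) : hess f x h k = hess f x k h :=
  hf.contDiffAt.isSymmSndFDerivAt (by simp) h k

lemma continuous_hess_line (hf : ContDiff ℝ 2 f) (x u : E) :
    Continuous fun t : ℝ ↦ hess f (x + t • u) :=
  (continuous_hess hf).comp (by fun_prop)

lemma integralHess_apply (hf : ContDiff ℝ 2 f) (x u h k : E) :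
    integralHess f x u h k = ∫ t in (0 : ℝ)..1, hess f (x + t • u) h k := by
  have h1 := (continuous_hess_line hf x u)
  have h2 : Continuous fun t : ℝ ↦ hess f (x + t • u) h := h1.clm_apply continuous_const
  rw [integralHess, ContinuousLinearMap.intervalIntegral_apply (h1.intervalIntegrable 0 1),
    ContinuousLinearMap.intervalIntegral_apply (h2.intervalIntegrable 0 1)]

/-- The gradient difference is the integral Hessian applied to the step. -/
lemma integralHess_apply_self [FiniteDimensional ℝ E] (hf : ContDiff ℝ 2 f) (x u : E) :
    integralHess f x u u = grad f (x + u) - grad f x := by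
  have h1 := continuous_hess_line hf x u
  have h2 : Continuous fun t : ℝ ↦ hess f (x + t • u) u := h1.clm_apply continuous_const
  rw [integralHess, ContinuousLinearMap.intervalIntegral_apply (h1.intervalIntegrable 0 1)]
  have hd : ∀ t ∈ Set.uIcc (0 : ℝ) 1,
      HasDerivAt (fun t : ℝ ↦ grad f (x + t • u)) (hess f (x + t • u) u) t := by
    intro t _
    have hline : HasDerivAt (fun t : ℝ ↦ x + t • u) u t := by
      simpa using ((hasDerivAt_id t).smul_const u).const_add x
    exact (hasFDerivAt_grad hf (x + t • u)).comp_hasDerivAt t hline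
  rw [intervalIntegral.integral_eq_sub_of_hasDerivAt hd (h2.intervalIntegrable 0 1)]
  simp

lemma primalNorm_smul (A : Op E) (t : ℝ) (u : E) :
    primalNorm A (t • u) = |t| * primalNorm A u := by
  rw [primalNorm, primalNorm, map_smul, map_smul, smul_apply, smul_smul, smul_eq_mul,
    ← sq, Real.sqrt_mul (sq_nonneg t), Real.sqrt_sq_eq_abs]

lemma integralHess_symm (hf : ContDiff ℝ 2 f) (x u h k : E) :
    integralHess f x u h k = integralHess f x u k h := by
  rw [integralHess_apply hf, integralHess_apply hf]
  simp only [hess_symm hf _ h k]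

lemma continuous_hess_line_apply (hf : ContDiff ℝ 2 f) (x u h k : E) :
    Continuous fun t : ℝ ↦ hess f (x + t • u) h k :=
  ((continuous_hess_line hf x u).clm_apply continuous_const).clm_apply continuous_const

lemma le_integralHess (hf : ContDiff ℝ 2 f) {x u h : E} {c : ℝ} (hc : ∀ y, c ≤ hess f y h h) :
    c ≤ integralHess f x u h h := by
  rw [integralHess_apply hf]
  calc c = ∫ _ in (0 : ℝ)..1, c := by simp
    _ ≤ _ := intervalIntegral.integral_mono_on zero_le_one (by simp)
      ((continuous_hess_line_apply hf x u h h).intervalIntegrable 0 1) fun t _ ↦ hc _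

lemma IsPosDef.integralHess {B : Op E} (hB : IsPosDef B) (hf : ContDiff ℝ 2 f) {μ : ℝ}
    (hμ : 0 < μ) (hle : ∀ x h, μ * B h h ≤ hess f x h h) (x u : E) :
    IsPosDef (integralHess f x u) :=
  hB.of_le (integralHess_symm hf x u) hμ fun h ↦ le_integralHess hf fun y ↦ hle y h

variable {M : ℝ}

/-- Self-concordance is used in both directions along the line. The reference points z and w remain
free, which later allows either end of a step or an intermediate point to serve. -/
lemma StronglySelfConcordant.abs_sub_le (hsc : StronglySelfConcordant f M) (x z w u h : E)
    (s t : ℝ) : |hess f (x + t • u) h h - hess f (x + s • u) h h| ≤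
      |t - s| * (M * primalNorm (hess f z) u * hess f w h h) := by
  have h1 := hsc (x + s • u) (x + t • u) z w h
  have h2 := hsc (x + t • u) (x + s • u) z w h
  have e1 : x + t • u - (x + s • u) = (t - s) • u := by module
  have e2 : x + s • u - (x + t • u) = (s - t) • u := by module
  rw [e1, primalNorm_smul] at h1
  rw [e2, primalNorm_smul, abs_sub_comm] at h2
  simp only [sub_apply, smul_apply, smul_eq_mul] at h1 h2
  rw [abs_le]
  constructor <;> linarith

/-- The factor 1/2 is the integral of |t − s| over [0, 1], the same at both ends s = 0 and s = 1. -/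
lemma abs_integralHess_sub_le (hf : ContDiff ℝ 2 f) (hsc : StronglySelfConcordant f M)
    (x z w u h : E) {s : ℝ} (hs : s = 0 ∨ s = 1) :
    |integralHess f x u h h - hess f (x + s • u) h h| ≤
      M * primalNorm (hess f z) u / 2 * hess f w h h := by
  have hc := continuous_hess_line_apply hf x u h h
  have e : integralHess f x u h h - hess f (x + s • u) h h =
      ∫ t in (0 : ℝ)..1, (hess f (x + t • u) h h - hess f (x + s • u) h h) := by
    rw [integralHess_apply hf, intervalIntegral.integral_sub (hc.intervalIntegrable 0 1) (by simp)]
    simp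
  have hbound : ∀ g : ℝ → ℝ, Continuous g → (∫ t in (0 : ℝ)..1, g t) = 1 / 2 →
      (∀ t ∈ Set.Ioc (0 : ℝ) 1, |t - s| = g t) →
      |integralHess f x u h h - hess f (x + s • u) h h| ≤
        M * primalNorm (hess f z) u / 2 * hess f w h h := by
    intro g hg hint hgs
    rw [e, ← Real.norm_eq_abs]
    calc _ ≤ ∫ t in (0 : ℝ)..1, g t * (M * primalNorm (hess f z) u * hess f w h h) := by
          refine intervalIntegral.norm_integral_le_of_norm_le zero_le_one
            (Filter.Eventually.of_forall fun t ht ↦ ?_)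
            ((hg.mul continuous_const).intervalIntegrable 0 1)
          rw [← hgs t ht, Real.norm_eq_abs]
          exact hsc.abs_sub_le x z w u h s t
      _ = _ := by
          rw [intervalIntegral.integral_mul_const, hint]
          ring
  rcases hs with rfl | rfl
  · refine hbound (fun t ↦ t) continuous_id (by simp) fun t ht ↦ ?_
    rw [sub_zero, abs_of_pos ht.1]
  · refine hbound (fun t ↦ 1 - t) (by fun_prop) ?_ fun t ht ↦ ?_
    · rw [intervalIntegral.integral_sub (by simp) (by simp)]
      norm_num
    · rw [abs_of_nonpos (by linarith [ht.2])]
      ring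

/-- Averaging the previous estimate over w = x + tu replaces the Hessian on the right by the
integral Hessian. -/
lemma abs_integralHess_sub_le_integralHess (hf : ContDiff ℝ 2 f)
    (hsc : StronglySelfConcordant f M) (x z u h : E) {s : ℝ} (hs : s = 0 ∨ s = 1) :
    |integralHess f x u h h - hess f (x + s • u) h h| ≤
      M * primalNorm (hess f z) u / 2 * integralHess f x u h h := by
  have hc := continuous_hess_line_apply hf x u h h
  calc _ = ∫ _ in (0 : ℝ)..1, |integralHess f x u h h - hess f (x + s • u) h h| := by simp
    _ ≤ ∫ t in (0 : ℝ)..1, M * primalNorm (hess f z) u / 2 * hess f (x + t • u) h h :=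
        intervalIntegral.integral_mono_on zero_le_one (by simp)
          ((continuous_const.mul hc).intervalIntegrable 0 1) fun t _ ↦
            abs_integralHess_sub_le hf hsc x z _ u h hs
    _ = _ := by rw [intervalIntegral.integral_const_mul, integralHess_apply hf x u h h]

end Hessian

/-! ### Superadditivity of the geometric mean -/

section GeometricMean

/-- `1 + (∏ x)^{1/k} ≤ (∏ (1 + x))^{1/k}` in exponential form. -/
lemma prod_rpow_le_exp_sub_one {k : ℕ} (hk : 1 ≤ k) {x : ℕ → ℝ} (hx : ∀ i, 0 ≤ x i) {C : ℝ}
    (hC : ∑ i ∈ Finset.range k, Real.log (1 + x i) ≤ C) :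
    ∏ i ∈ Finset.range k, x i ^ (1 / (k : ℝ)) ≤ Real.exp (C / k) - 1 := by
  have hk0 : (0 : ℝ) < k := by exact_mod_cast hk
  have hy : ∀ i, 0 < 1 + x i := fun i ↦ by linarith [hx i]
  have hw : ∑ _i ∈ Finset.range k, (1 / (k : ℝ)) = 1 := by
    simp [hk0.ne']
  -- AM–GM is applied to 1/(1 + x_i) and to x_i/(1 + x_i); the two arithmetic means add up to 1.
  have h1 := Real.geom_mean_le_arith_mean_weighted (Finset.range k) (fun _ ↦ 1 / (k : ℝ))
    (fun i ↦ 1 / (1 + x i)) (fun _ _ ↦ by positivity) hw (fun i _ ↦ by have := hy i; positivity)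
  have h2 := Real.geom_mean_le_arith_mean_weighted (Finset.range k) (fun _ ↦ 1 / (k : ℝ))
    (fun i ↦ x i / (1 + x i)) (fun _ _ ↦ by positivity) hw
    (fun i _ ↦ div_nonneg (hx i) (hy i).le)
  have h3 : ∑ i ∈ Finset.range k, 1 / (k : ℝ) * (1 / (1 + x i)) +
      ∑ i ∈ Finset.range k, 1 / (k : ℝ) * (x i / (1 + x i)) = 1 := by
    rw [← Finset.sum_add_distrib]
    refine Eq.trans ?_ hw
    refine Finset.sum_congr rfl fun i _ ↦ ?_
    have := (hy i).ne'
    field_simp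
  set Y := ∏ i ∈ Finset.range k, (1 + x i) ^ (1 / (k : ℝ)) with hY
  have hY0 : 0 < Y := Finset.prod_pos fun i _ ↦ Real.rpow_pos_of_pos (hy i) _
  have e1 : ∏ i ∈ Finset.range k, (1 / (1 + x i)) ^ (1 / (k : ℝ)) = 1 / Y := by
    rw [hY, one_div (∏ i ∈ _, _), ← Finset.prod_inv_distrib]
    refine Finset.prod_congr rfl fun i _ ↦ ?_
    rw [one_div (1 + x i), Real.inv_rpow (hy i).le]
  have e2 : ∏ i ∈ Finset.range k, (x i / (1 + x i)) ^ (1 / (k : ℝ)) =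
      (∏ i ∈ Finset.range k, x i ^ (1 / (k : ℝ))) / Y := by
    rw [hY, ← Finset.prod_div_distrib]
    exact Finset.prod_congr rfl fun i _ ↦ Real.div_rpow (hx i) (hy i).le _
  rw [e1] at h1
  rw [e2] at h2
  have h4 : 1 / Y + (∏ i ∈ Finset.range k, x i ^ (1 / (k : ℝ))) / Y ≤ 1 := by linarith
  rw [← add_div, div_le_one hY0] at h4
  have h5 : Y ≤ Real.exp (C / k) := by
    rw [← Real.log_le_iff_le_exp hY0, hY,
      Real.log_prod (fun i _ ↦ (Real.rpow_pos_of_pos (hy i) _).ne'), le_div_iff₀ hk0]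
    simp only [Real.log_rpow (hy _)]
    rw [← Finset.mul_sum, mul_comm, ← mul_assoc, mul_one_div_cancel hk0.ne', one_mul]
    exact hC
  linarith

end GeometricMean

/-! ### Spectral bounds along the run and linear convergence -/

section Scheme

variable {E : Type*} [NormedAddCommGroup E] [NormedSpace ℝ E]

/-- The standing assumptions on the objective and on the run of the scheme, with `μ ≤ L`. -/
structure Run (f : E → ℝ) (B : Op E) (μ L M : ℝ) (x : ℕ → E) (G : ℕ → Op E) (τ : ℕ → ℝ) :
    Prop where
  smooth : ContDiff ℝ 2 f
  posDef_ref : IsPosDef B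
  mu_pos : 0 < μ
  L_pos : 0 < L
  mu_le_L : μ ≤ L
  M_nonneg : 0 ≤ M
  mu_le : ∀ x h, μ * B h h ≤ hess f x h h
  le_L : ∀ x h, hess f x h h ≤ L * B h h
  sc : StronglySelfConcordant f M
  scheme : IsScheme f B L x G τ

/-- The Hessian at the `k`-th iterate. -/
noncomputable def iterHess (f : E → ℝ) (x : ℕ → E) (k : ℕ) : Op E := hess f (x k)

/-- The integral Hessian along the `k`-th step. -/
noncomputable def stepHess (f : E → ℝ) (x : ℕ → E) (k : ℕ) : Op E :=
  integralHess f (x k) (x (k + 1) - x k)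

/-- The local norm of the `k`-th step. -/
noncomputable def stepNorm (f : E → ℝ) (x : ℕ → E) (k : ℕ) : ℝ :=
  primalNorm (hess f (x k)) (x (k + 1) - x k)

/-- The scaled length of the path of the first `k` steps. -/
noncomputable def pathLength (f : E → ℝ) (M : ℝ) (x : ℕ → E) (k : ℕ) : ℝ :=
  M * ∑ i ∈ Finset.range k, stepNorm f x i

lemma stepNorm_nonneg (f : E → ℝ) (x : ℕ → E) (k : ℕ) : 0 ≤ stepNorm f x k := Real.sqrt_nonneg _

lemma localGradNorm_nonneg (f : E → ℝ) (x : E) : 0 ≤ localGradNorm f x := Real.sqrt_nonneg _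

lemma pathLength_succ (f : E → ℝ) (M : ℝ) (x : ℕ → E) (k : ℕ) :
    pathLength f M x (k + 1) = pathLength f M x k + M * stepNorm f x k := by
  rw [pathLength, pathLength, Finset.sum_range_succ, mul_add]

lemma pathLength_mono (f : E → ℝ) {M : ℝ} (hM : 0 ≤ M) (x : ℕ → E) :
    Monotone (pathLength f M x) :=
  monotone_nat_of_le_succ fun k ↦ by
    rw [pathLength_succ]
    have := mul_nonneg hM (stepNorm_nonneg f x k)
    linarith

lemma pathLength_nonneg (f : E → ℝ) {M : ℝ} (hM : 0 ≤ M) (x : ℕ → E) (k : ℕ) :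
    0 ≤ pathLength f M x k :=
  mul_nonneg hM (Finset.sum_nonneg fun i _ ↦ stepNorm_nonneg f x i)

namespace Run

variable {f : E → ℝ} {B : Op E} {μ L M : ℝ} {x : ℕ → E} {G : ℕ → Op E} {τ : ℕ → ℝ}

lemma posDef_iterHess (hR : Run f B μ L M x G τ) (k : ℕ) : IsPosDef (iterHess f x k) :=
  hR.posDef_ref.of_le (hess_symm hR.smooth _) hR.mu_pos fun h ↦ hR.mu_le _ h

lemma posDef_stepHess (hR : Run f B μ L M x G τ) (k : ℕ) : IsPosDef (stepHess f x k) :=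
  hR.posDef_ref.integralHess hR.smooth hR.mu_pos hR.mu_le _ _

lemma step_nonneg (hR : Run f B μ L M x G τ) (k : ℕ) : 0 ≤ M * stepNorm f x k :=
  mul_nonneg hR.M_nonneg (stepNorm_nonneg f x k)

lemma abs_stepHess_sub_iterHess_le (hR : Run f B μ L M x G τ) (k : ℕ) (h : E) :
    |stepHess f x k h h - iterHess f x k h h| ≤ M * stepNorm f x k / 2 * iterHess f x k h h := by
  simpa [stepHess, iterHess, stepNorm] using abs_integralHess_sub_le hR.smooth hR.sc (x k) (x k) (x k) (x (k + 1) - x k) h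
    (Or.inl rfl)

lemma abs_stepHess_sub_iterHess_succ_le (hR : Run f B μ L M x G τ) (k : ℕ) (h : E) :
    |stepHess f x k h h - iterHess f x (k + 1) h h| ≤
      M * stepNorm f x k / 2 * iterHess f x (k + 1) h h := by
  simpa [stepHess, iterHess, stepNorm] using abs_integralHess_sub_le hR.smooth hR.sc (x k) (x k) (x (k + 1)) (x (k + 1) - x k) h
    (Or.inr rfl)

lemma abs_stepHess_sub_iterHess_le_stepHess (hR : Run f B μ L M x G τ) (k : ℕ) (h : E) :
    |stepHess f x k h h - iterHess f x k h h| ≤ M * stepNorm f x k / 2 * stepHess f x k h h := by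
  simpa [stepHess, iterHess, stepNorm] using abs_integralHess_sub_le_integralHess hR.smooth hR.sc (x k) (x k)
    (x (k + 1) - x k) h (Or.inl rfl)

lemma abs_stepHess_sub_iterHess_succ_le_stepHess (hR : Run f B μ L M x G τ) (k : ℕ) (h : E) :
    |stepHess f x k h h - iterHess f x (k + 1) h h| ≤
      M * stepNorm f x k / 2 * stepHess f x k h h := by
  simpa [stepHess, iterHess, stepNorm] using abs_integralHess_sub_le_integralHess hR.smooth hR.sc (x k) (x k)
    (x (k + 1) - x k) h (Or.inr rfl)

/-- All four comparisons between the integral Hessian of a step and the Hessians at its ends. -/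
lemma stepHess_compare (hR : Run f B μ L M x G τ) (k : ℕ) (h : E) :
    stepHess f x k h h ≤ (1 + M * stepNorm f x k / 2) * iterHess f x k h h ∧
    iterHess f x k h h ≤ (1 + M * stepNorm f x k / 2) * stepHess f x k h h ∧
    stepHess f x k h h ≤ (1 + M * stepNorm f x k / 2) * iterHess f x (k + 1) h h ∧
    iterHess f x (k + 1) h h ≤ (1 + M * stepNorm f x k / 2) * stepHess f x k h h := by
  have h1 := abs_le.1 (hR.abs_stepHess_sub_iterHess_le k h)
  have h2 := abs_le.1 (hR.abs_stepHess_sub_iterHess_succ_le k h)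
  have h3 := abs_le.1 (hR.abs_stepHess_sub_iterHess_le_stepHess k h)
  have h4 := abs_le.1 (hR.abs_stepHess_sub_iterHess_succ_le_stepHess k h)
  refine ⟨?_, ?_, ?_, ?_⟩ <;> linarith [h1.1, h1.2, h2.1, h2.2, h3.1, h3.2, h4.1, h4.2]

lemma one_add_le_exp (f : E → ℝ) (M : ℝ) (x : ℕ → E) (k : ℕ) :
    1 + M * stepNorm f x k / 2 ≤ Real.exp (M * stepNorm f x k / 2) := by
  linarith [Real.add_one_le_exp (M * stepNorm f x k / 2)]

lemma one_le_cond (hR : Run f B μ L M x G τ) : 1 ≤ L / μ := by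
  rw [le_div_iff₀ hR.mu_pos]; linarith [hR.mu_le_L]

/-- Passing the spectral bounds from the Hessian at `x k` to the integral Hessian. -/
lemma stepHess_bounds (hR : Run f B μ L M x G τ) {k : ℕ} {c : ℝ}
    (h1 : ∀ h, iterHess f x k h h ≤ Real.exp c * G k h h)
    (h2 : ∀ h, G k h h ≤ Real.exp c * (L / μ) * iterHess f x k h h) :
    (∀ h, stepHess f x k h h ≤ Real.exp (c + M * stepNorm f x k / 2) * G k h h) ∧
    ∀ h, G k h h ≤ Real.exp (c + M * stepNorm f x k / 2) * (L / μ) * stepHess f x k h h := by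
  have hc := hR.one_le_cond
  have he := one_add_le_exp f M x k
  have hs := hR.step_nonneg k
  constructor
  · intro h
    calc _ ≤ (1 + M * stepNorm f x k / 2) * iterHess f x k h h := (hR.stepHess_compare k h).1
      _ ≤ Real.exp (M * stepNorm f x k / 2) * (Real.exp c * G k h h) :=
        mul_le_mul he (h1 h) ((hR.posDef_iterHess k).nonneg h) (Real.exp_pos _).le
      _ = _ := by rw [Real.exp_add]; ring
  · intro h
    calc _ ≤ Real.exp c * (L / μ) * iterHess f x k h h := h2 h
      _ ≤ Real.exp c * (L / μ) * (Real.exp (M * stepNorm f x k / 2) * stepHess f x k h h) := by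
        refine mul_le_mul_of_nonneg_left ?_ (mul_nonneg (Real.exp_pos _).le (by linarith))
        exact (hR.stepHess_compare k h).2.1.trans
          (mul_le_mul_of_nonneg_right he ((hR.posDef_stepHess k).nonneg h))
      _ = _ := by rw [Real.exp_add]; ring

lemma step_eq (hR : Run f B μ L M x G τ) (k : ℕ) :
    x (k + 1) - x k = -(G k).inverse (grad f (x k)) := by
  rw [hR.scheme.step k]; abel

lemma rate_mem (hR : Run f B μ L M x G τ) :
    1 / 2 ≤ 1 - μ / (2 * L) ∧ 1 - μ / (2 * L) ≤ 1 := by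
  have h1 : μ / (2 * L) ≤ 1 / 2 := by
    rw [div_le_div_iff₀ (by linarith [hR.L_pos]) (by norm_num)]; linarith [hR.mu_le_L]
  have h2 : 0 ≤ μ / (2 * L) := div_nonneg hR.mu_pos.le (by linarith [hR.L_pos])
  constructor <;> linarith

variable [FiniteDimensional ℝ E]

/-- The spectral bounds along the run. -/
lemma bounds (hR : Run f B μ L M x G τ) (k : ℕ) : IsPosDef (G k) ∧
    (∀ h, iterHess f x k h h ≤ Real.exp (pathLength f M x k) * G k h h) ∧
    ∀ h, G k h h ≤ Real.exp (pathLength f M x k) * (L / μ) * iterHess f x k h h := by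
  induction k with
  | zero =>
    have hG : G 0 = L • B := hR.scheme.init
    refine ⟨hG ▸ hR.posDef_ref.smul hR.L_pos, fun h ↦ ?_, fun h ↦ ?_⟩
    · simpa [pathLength, hG, iterHess] using hR.le_L (x 0) h
    · have h1 := mul_le_mul_of_nonneg_left (hR.mu_le (x 0) h) (div_pos hR.L_pos hR.mu_pos).le
      have := hR.mu_pos.ne'
      simp only [pathLength, Finset.range_zero, Finset.sum_empty, mul_zero, Real.exp_zero, one_mul,
        hG, smul_apply, smul_eq_mul]
      calc L * B h h = L / μ * (μ * B h h) := by field_simp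
        _ ≤ _ := h1
  | succ k ih =>
    obtain ⟨hG, h1, h2⟩ := ih
    obtain ⟨h3, h4⟩ := hR.stepHess_bounds h1 h2
    have hc := hR.one_le_cond
    have he := one_add_le_exp f M x k
    have hs := hR.step_nonneg k
    have hJ := hR.posDef_stepHess k
    have hone : 1 ≤ Real.exp (pathLength f M x k + M * stepNorm f x k / 2) := by
      rw [← Real.exp_zero]
      refine Real.exp_le_exp.2 ?_
      have := pathLength_nonneg f hR.M_nonneg x k
      linarith
    have hGs : G (k + 1) = broyd (τ k) (stepHess f x k) (G k) (x (k + 1) - x k) :=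
      hR.scheme.update k
    have hGp : IsPosDef (G (k + 1)) := by
      rw [hGs]; exact hJ.broyd hG (hR.scheme.tau_mem k) hone h3 _
    have h5 : ∀ h, stepHess f x k h h ≤
        Real.exp (pathLength f M x k + M * stepNorm f x k / 2) * G (k + 1) h h := by
      rw [hGs]; exact le_broyd hJ hG (hR.scheme.tau_mem k) hone h3 _
    have h6 : ∀ h, G (k + 1) h h ≤
        Real.exp (pathLength f M x k + M * stepNorm f x k / 2) * (L / μ) *
          stepHess f x k h h := by
      rw [hGs]
      exact broyd_le hJ hG (hR.scheme.tau_mem k) (one_le_mul_of_one_le_of_one_le hone hc) h4 _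
    -- One half of the increment Mr_k pays for replacing H_k by J_k, the other for replacing J_k by
    -- H_{k+1}.
    have hexp : Real.exp (pathLength f M x (k + 1)) = Real.exp (M * stepNorm f x k / 2) *
        Real.exp (pathLength f M x k + M * stepNorm f x k / 2) := by
      rw [pathLength_succ, ← Real.exp_add]; ring_nf
    refine ⟨hGp, fun h ↦ ?_, fun h ↦ ?_⟩
    · calc _ ≤ (1 + M * stepNorm f x k / 2) * stepHess f x k h h :=
            (hR.stepHess_compare k h).2.2.2
        _ ≤ Real.exp (M * stepNorm f x k / 2) *
            (Real.exp (pathLength f M x k + M * stepNorm f x k / 2) * G (k + 1) h h) :=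
          mul_le_mul he (h5 h) (hJ.nonneg h) (Real.exp_pos _).le
        _ = _ := by rw [hexp]; ring
    · calc _ ≤ _ := h6 h
        _ ≤ Real.exp (pathLength f M x k + M * stepNorm f x k / 2) * (L / μ) *
            (Real.exp (M * stepNorm f x k / 2) * iterHess f x (k + 1) h h) := by
          refine mul_le_mul_of_nonneg_left ?_ (mul_nonneg (Real.exp_pos _).le (by linarith))
          exact (hR.stepHess_compare k h).2.2.1.trans
            (mul_le_mul_of_nonneg_right he ((hR.posDef_iterHess (k + 1)).nonneg h))
        _ = _ := by rw [hexp]; ring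

lemma posDef_G (hR : Run f B μ L M x G τ) (k : ℕ) : IsPosDef (G k) := (hR.bounds k).1

lemma exp_le_of_le_log {c : ℝ} (hc : c ≤ Real.log (3 / 2)) : Real.exp c ≤ 3 / 2 := by
  rwa [← Real.le_log_iff_exp_le (by norm_num)]

lemma iterHess_bounds (hR : Run f B μ L M x G τ) {k : ℕ}
    (hk : pathLength f M x k ≤ Real.log (3 / 2)) :
    (∀ h, iterHess f x k h h ≤ 3 / 2 * G k h h) ∧
    ∀ h, G k h h ≤ 3 * L / (2 * μ) * iterHess f x k h h := by
  obtain ⟨hG, h1, h2⟩ := hR.bounds k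
  have he := exp_le_of_le_log hk
  refine ⟨fun h ↦ (h1 h).trans (mul_le_mul_of_nonneg_right he (hG.nonneg h)), fun h ↦ ?_⟩
  refine (h2 h).trans (mul_le_mul_of_nonneg_right ?_ ((hR.posDef_iterHess k).nonneg h))
  calc _ ≤ 3 / 2 * (L / μ) :=
        mul_le_mul_of_nonneg_right he (div_pos hR.L_pos hR.mu_pos).le
    _ = _ := by ring

lemma stepHess_bounds_of_le (hR : Run f B μ L M x G τ) {k : ℕ}
    (hk : pathLength f M x (k + 1) ≤ Real.log (3 / 2)) :
    (∀ h, stepHess f x k h h ≤ 3 / 2 * G k h h) ∧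
    ∀ h, G k h h ≤ 3 * L / (2 * μ) * stepHess f x k h h := by
  obtain ⟨hG, h1, h2⟩ := hR.bounds k
  obtain ⟨h3, h4⟩ := hR.stepHess_bounds h1 h2
  have hs := hR.step_nonneg k
  have he : Real.exp (pathLength f M x k + M * stepNorm f x k / 2) ≤ 3 / 2 := by
    refine exp_le_of_le_log ?_
    rw [pathLength_succ] at hk
    linarith
  refine ⟨fun h ↦ (h3 h).trans (mul_le_mul_of_nonneg_right he (hG.nonneg h)), fun h ↦ ?_⟩
  refine (h4 h).trans (mul_le_mul_of_nonneg_right ?_ ((hR.posDef_stepHess k).nonneg h))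
  calc _ ≤ 3 / 2 * (L / μ) :=
        mul_le_mul_of_nonneg_right he (div_pos hR.L_pos hR.mu_pos).le
    _ = _ := by ring

lemma G_step (hR : Run f B μ L M x G τ) (k : ℕ) :
    G k (x (k + 1) - x k) = -grad f (x k) := by
  rw [hR.step_eq, map_neg, (hR.posDef_G k).apply_inverse]

lemma grad_succ (hR : Run f B μ L M x G τ) (k : ℕ) : grad f (x (k + 1)) =
    stepHess f x k (x (k + 1) - x k) - G k (x (k + 1) - x k) := by
  rw [stepHess, integralHess_apply_self hR.smooth, hR.G_step]
  simp

/-- The squared norm of the `k`-th gradient with respect to `G k`. -/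
lemma G_step_step (hR : Run f B μ L M x G τ) (k : ℕ) :
    G k (x (k + 1) - x k) (x (k + 1) - x k) =
      grad f (x k) ((G k).inverse (grad f (x k))) := by
  rw [hR.G_step, hR.step_eq]; simp

lemma localGradNorm_sq (hR : Run f B μ L M x G τ) (k : ℕ) :
    localGradNorm f (x k) ^ 2 =
      grad f (x k) ((iterHess f x k).inverse (grad f (x k))) :=
  Real.sq_sqrt ((hR.posDef_iterHess k).apply_inverse_nonneg _)

/-- Since ‖u_k‖_{G_k} is the G_k⁻¹-norm of the gradient, H_k ⪯ (3/2)G_k is used twice, once for the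
step and once for the gradient, each time costing √(3/2). -/
lemma stepNorm_le (hR : Run f B μ L M x G τ) {k : ℕ}
    (hk : pathLength f M x k ≤ Real.log (3 / 2)) :
    stepNorm f x k ≤ 3 / 2 * localGradNorm f (x k) := by
  have hb := hR.iterHess_bounds hk
  have h1 := hb.1 (x (k + 1) - x k)
  rw [hR.G_step_step] at h1
  have h2 := (hR.posDef_iterHess k).inverse_le (hR.posDef_G k) (by norm_num) hb.1 (grad f (x k))
  rw [← hR.localGradNorm_sq] at h2
  refine Real.sqrt_le_iff.2 ⟨mul_nonneg (by norm_num) (localGradNorm_nonneg _ _), ?_⟩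
  change iterHess f x k _ _ ≤ _
  nlinarith

/-- The contraction takes place in the metric of J_k; moving the norm from H_k to J_k and then to
H_{k+1} costs √(1 + Mr_k/2) each time. -/
lemma localGradNorm_succ_le (hR : Run f B μ L M x G τ) {k : ℕ}
    (hk : pathLength f M x (k + 1) ≤ Real.log (3 / 2)) :
    localGradNorm f (x (k + 1)) ≤
      (1 - μ / (2 * L)) * Real.exp (M * stepNorm f x k / 2) * localGradNorm f (x k) := by
  have hb := hR.stepHess_bounds_of_le hk
  have hJ := hR.posDef_stepHess k
  have hs := hR.step_nonneg k
  have hμ := hR.mu_pos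
  have hL := hR.L_pos
  obtain ⟨hq1, hq2⟩ := hR.rate_mem
  set q := 1 - μ / (2 * L) with hq
  set e := 1 + M * stepNorm f x k / 2 with he
  have he0 : 0 < e := by positivity
  have h1 := hJ.contraction (hR.posDef_G k) (ξ := 3 / 2) (η := 3 * L / (2 * μ)) (q := q)
    (by norm_num) (by positivity) (by linarith) (by linarith) ?_ hb.1 hb.2 (grad f (x k))
  · have hg : grad f (x k) - stepHess f x k ((G k).inverse (grad f (x k))) =
        grad f (x (k + 1)) := by
      rw [hR.grad_succ, hR.G_step, hR.step_eq]
      simp [sub_eq_add_neg, add_comm]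
    rw [hg] at h1
    have h2 := hJ.inverse_le (hR.posDef_iterHess (k + 1)) he0
      (fun h ↦ (hR.stepHess_compare k h).2.2.1) (grad f (x (k + 1)))
    have h3 := (hR.posDef_iterHess k).inverse_le hJ he0
      (fun h ↦ (hR.stepHess_compare k h).2.1) (grad f (x k))
    rw [← hR.localGradNorm_sq] at h2 h3
    have h4 : localGradNorm f (x (k + 1)) ^ 2 ≤ (q * e * localGradNorm f (x k)) ^ 2 :=
      calc _ ≤ e * (q ^ 2 * (e * localGradNorm f (x k) ^ 2)) :=
            h2.trans (mul_le_mul_of_nonneg_left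
              (h1.trans (mul_le_mul_of_nonneg_left h3 (sq_nonneg q))) he0.le)
        _ = _ := by ring
    have hlam := localGradNorm_nonneg f (x k)
    have hq0 : 0 ≤ q := by linarith
    calc _ ≤ q * e * localGradNorm f (x k) := abs_le_of_sq_le_sq' h4 (by positivity) |>.2
      _ ≤ _ := by
        have := one_add_le_exp f M x k
        gcongr
  · rw [one_div_div, hq]
    have : μ / (2 * L) ≤ 2 * μ / (3 * L) := by
      rw [div_le_div_iff₀ (by positivity) (by positivity)]
      nlinarith [mul_pos hμ hL]
    linarith

lemma localGradNorm_le_exp (hR : Run f B μ L M x G τ) (k : ℕ)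
    (hk : pathLength f M x k ≤ Real.log (3 / 2)) :
    localGradNorm f (x k) ≤
      (1 - μ / (2 * L)) ^ k * Real.exp (pathLength f M x k / 2) * localGradNorm f (x 0) := by
  induction k with
  | zero => simp [pathLength]
  | succ k ih =>
    have hmono := pathLength_mono f hR.M_nonneg x (Nat.le_succ k)
    have hq := hR.rate_mem
    have hq0 : 0 ≤ 1 - μ / (2 * L) := by linarith [hq.1]
    calc _ ≤ _ := hR.localGradNorm_succ_le hk
      _ ≤ (1 - μ / (2 * L)) * Real.exp (M * stepNorm f x k / 2) * ((1 - μ / (2 * L)) ^ k *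
          Real.exp (pathLength f M x k / 2) * localGradNorm f (x 0)) := by
        gcongr
        exact ih (hmono.trans hk)
      _ = _ := by
        rw [pathLength_succ, add_div, Real.exp_add]; ring

/-- Linear convergence. -/
lemma localGradNorm_le_linear (hR : Run f B μ L M x G τ) {k : ℕ}
    (hk : pathLength f M x k ≤ Real.log (3 / 2)) :
    localGradNorm f (x k) ≤
      (1 - μ / (2 * L)) ^ k * Real.sqrt (3 / 2) * localGradNorm f (x 0) := by
  refine (hR.localGradNorm_le_exp k hk).trans ?_
  have hq := hR.rate_mem
  have hq0 : 0 ≤ 1 - μ / (2 * L) := by linarith [hq.1]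
  have hlam := localGradNorm_nonneg f (x 0)
  gcongr
  rw [Real.exp_half]
  exact Real.sqrt_le_sqrt (exp_le_of_le_log hk)

end Run

end Scheme

/-! ### Total decrease of the potential and superlinear convergence -/

namespace Run

variable {E : Type*} [NormedAddCommGroup E] [NormedSpace ℝ E]
  {f : E → ℝ} {B : Op E} {μ L M : ℝ} {x : ℕ → E} {G : ℕ → Op E} {τ : ℕ → ℝ}

lemma weight_pos (hR : Run f B μ L M x G τ) {t : ℝ} (ht : t ∈ Set.Icc (0 : ℝ) 1) :
    0 < weight μ L t ∧ weight μ L t ≤ 1 := by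
  have hμ := hR.mu_pos
  have hL := hR.L_pos
  have h1 : 0 < 4 * μ / (9 * L) := by positivity
  have h2 : 4 * μ / (9 * L) ≤ 1 := by
    rw [div_le_one (by positivity)]; linarith [hR.mu_le_L]
  rw [weight]
  constructor
  · nlinarith [ht.1, ht.2]
  · nlinarith [ht.1, ht.2]

/-- The base of the superlinear rate. -/
noncomputable def rateBase (n : ℕ) (μ L : ℝ) (τ : ℕ → ℝ) (k : ℕ) : ℝ :=
  5 / (2 * ∏ i ∈ Finset.range k, weight μ L (τ i) ^ (1 / (k : ℝ))) *
    (Real.exp (13 / 6 * ((n : ℝ) / k) * Real.log (2 * L / μ)) - 1)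

lemma log_two_cond_nonneg (hR : Run f B μ L M x G τ) : 0 ≤ Real.log (2 * L / μ) := by
  have hμ := hR.mu_pos
  refine Real.log_nonneg ?_
  rw [le_div_iff₀ hμ]
  linarith [hR.mu_le_L, hR.L_pos]

lemma rateBase_nonneg (hR : Run f B μ L M x G τ) (n k : ℕ) : 0 ≤ rateBase n μ L τ k := by
  have hlog := hR.log_two_cond_nonneg
  have h1 : 0 ≤ Real.exp (13 / 6 * ((n : ℝ) / k) * Real.log (2 * L / μ)) - 1 := by
    have : 0 ≤ 13 / 6 * ((n : ℝ) / k) * Real.log (2 * L / μ) := by positivity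
    linarith [Real.one_le_exp this]
  have h2 : 0 ≤ ∏ i ∈ Finset.range k, weight μ L (τ i) ^ (1 / (k : ℝ)) :=
    Finset.prod_nonneg fun i _ ↦ Real.rpow_nonneg (hR.weight_pos (hR.scheme.tau_mem i)).1.le _
  exact mul_nonneg (div_nonneg (by norm_num) (by linarith)) h1

/-- The decrease of the potential at the `k`-th update. -/
noncomputable def decrease (f : E → ℝ) (x : ℕ → E) (G : ℕ → Op E) (k : ℕ) : ℝ :=
  relTrace (G k) (stepHess f x k) - relTrace (G (k + 1)) (stepHess f x k)
    + Real.log (relDet (G (k + 1)) (G k))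

variable [FiniteDimensional ℝ E]

lemma relTrace_iterHess_le (hR : Run f B μ L M x G τ) {k : ℕ}
    (hk : pathLength f M x k ≤ Real.log (3 / 2)) :
    relTrace (G k) (iterHess f x k) ≤ 3 / 2 * Module.finrank ℝ E := by
  have h := relTrace_mono (hR.posDef_G k) (A₁ := iterHess f x k) (A₂ := (3 / 2 : ℝ) • G k)
    fun h ↦ by simpa using (hR.iterHess_bounds hk).1 h
  rwa [relTrace_smul, relTrace_self (hR.posDef_G k)] at h

/-- The sum telescopes except that the target J_k changes at each step. Comparing J_k with H_k and
H_{k+1} costs Mr_k/2 times a trace of at most 3n/2 on each side, which accumulates to the term with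
the path length. -/
lemma sum_decrease_aux (hR : Run f B μ L M x G τ) (k : ℕ)
    (hk : pathLength f M x k ≤ Real.log (3 / 2)) :
    ∑ i ∈ Finset.range k, decrease f x G i + relTrace (G k) (iterHess f x k) ≤
      Module.finrank ℝ E + 3 / 2 * Module.finrank ℝ E * pathLength f M x k
        + Real.log (relDet (G k) (G 0)) := by
  induction k with
  | zero =>
    have hG := hR.posDef_G 0
    have h0 : G 0 = L • B := hR.scheme.init
    have h := relTrace_mono hG (A₁ := iterHess f x 0) (A₂ := G 0)
      fun h ↦ by simpa [h0, iterHess] using hR.le_L (x 0) h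
    rw [relTrace_self hG] at h
    simpa [pathLength, relDet_self hG] using h
  | succ k ih =>
    have hk' := (pathLength_mono f hR.M_nonneg x (Nat.le_succ k)).trans hk
    have ih := ih hk'
    have hG := hR.posDef_G k
    have hG' := hR.posDef_G (k + 1)
    have hs := hR.step_nonneg k
    have h1 : relTrace (G k) (stepHess f x k) ≤
        (1 + M * stepNorm f x k / 2) * relTrace (G k) (iterHess f x k) := by
      rw [← relTrace_smul]
      exact relTrace_mono hG fun h ↦ by simpa using (hR.stepHess_compare k h).1
    have h2 : (1 - M * stepNorm f x k / 2) * relTrace (G (k + 1)) (iterHess f x (k + 1)) ≤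
        relTrace (G (k + 1)) (stepHess f x k) := by
      rw [← relTrace_smul]
      refine relTrace_mono hG' fun h ↦ ?_
      have := (abs_le.1 (hR.abs_stepHess_sub_iterHess_succ_le k h)).1
      simp only [smul_apply, smul_eq_mul]
      linarith
    have h3 := mul_le_mul_of_nonneg_left (hR.relTrace_iterHess_le hk')
      (by linarith : 0 ≤ M * stepNorm f x k / 2)
    have h4 := mul_le_mul_of_nonneg_left (hR.relTrace_iterHess_le hk)
      (by linarith : 0 ≤ M * stepNorm f x k / 2)
    have hlog : Real.log (relDet (G (k + 1)) (G 0)) =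
        Real.log (relDet (G (k + 1)) (G k)) + Real.log (relDet (G k) (G 0)) := by
      rw [← relDet_mul hG, Real.log_mul (relDet_pos hG' hG).ne'
        (relDet_pos hG (hR.posDef_G 0)).ne']
    rw [Finset.sum_range_succ, decrease, hlog, pathLength_succ]
    linarith

/-- The total decrease of the potential is at most `n ln (2 L / μ)`. -/
lemma sum_decrease_le (hR : Run f B μ L M x G τ) (k : ℕ)
    (hk : pathLength f M x k ≤ Real.log (3 / 2)) :
    ∑ i ∈ Finset.range k, decrease f x G i ≤
      Module.finrank ℝ E * Real.log (2 * L / μ) := by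
  have hμ := hR.mu_pos
  have hL := hR.L_pos
  have h1 := hR.sum_decrease_aux k hk
  have hH := hR.posDef_iterHess k
  have hG := hR.posDef_G k
  have hG0 := hR.posDef_G 0
  have h2 := log_relDet_le hG hH
  have h3 := log_relDet_le_of_le hH hG0 (c := L / μ) (by positivity) fun h ↦ by
    have h0 : G 0 = L • B := hR.scheme.init
    have h4 := mul_le_mul_of_nonneg_left (hR.mu_le (x k) h) (div_pos hL hμ).le
    rw [h0]
    simp only [smul_apply, smul_eq_mul]
    calc L * B h h = L / μ * (μ * B h h) := by field_simp
      _ ≤ _ := h4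
  have h5 : Real.log (relDet (G k) (G 0)) = Real.log (relDet (G k) (iterHess f x k)) +
      Real.log (relDet (iterHess f x k) (G 0)) := by
    rw [← relDet_mul hH, Real.log_mul (relDet_pos hG hH).ne' (relDet_pos hH hG0).ne']
  -- As (3/2)³ ≤ 2², the accumulated drift is at most n ln 2; this is the source of the 2 in 2L/μ.
  have h6 : 3 / 2 * Real.log (3 / 2) ≤ Real.log 2 := by
    have h7 : Real.log ((3 / 2 : ℝ) ^ 3) ≤ Real.log (2 ^ 2) :=
      Real.log_le_log (by norm_num) (by norm_num)
    rw [Real.log_pow, Real.log_pow] at h7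
    push_cast at h7
    linarith
  have h8 : Real.log (2 * L / μ) = Real.log 2 + Real.log (L / μ) := by
    rw [mul_div_assoc, Real.log_mul (by norm_num) (by positivity)]
  have hn : (0 : ℝ) ≤ Module.finrank ℝ E := Nat.cast_nonneg _
  have h9 := mul_le_mul_of_nonneg_left (show 3 / 2 * pathLength f M x k ≤ Real.log 2 by linarith)
    hn
  rw [h8]
  linarith

/-- The path condition is placed inside the existential so that `choose` yields one sequence ρ for
all k, with the value 0 where the condition fails. -/
lemma exists_ratio (hR : Run f B μ L M x G τ) (k : ℕ) : ∃ ρ : ℝ, 0 ≤ ρ ∧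
    (pathLength f M x (k + 1) ≤ Real.log (3 / 2) →
      6 / 13 * Real.log (1 + weight μ L (τ k) * ρ) ≤ decrease f x G k ∧
      grad f (x (k + 1)) ((G (k + 1)).inverse (grad f (x (k + 1)))) ≤
        5 / 2 * ρ * grad f (x k) ((G k).inverse (grad f (x k)))) := by
  by_cases hk : pathLength f M x (k + 1) ≤ Real.log (3 / 2)
  · have hb := hR.stepHess_bounds_of_le hk
    have hμ := hR.mu_pos
    have hL := hR.L_pos
    obtain ⟨ρ, hρ, h1, h2⟩ := broyd_step (hR.posDef_stepHess k) (hR.posDef_G k)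
      (hR.scheme.tau_mem k) (η := 3 * L / (2 * μ))
      (by rw [le_div_iff₀ (by positivity)]; linarith [hR.mu_le_L]) hb.1 hb.2 (x (k + 1) - x k)
    have hGs : broyd (τ k) (stepHess f x k) (G k) (x (k + 1) - x k) = G (k + 1) :=
      (hR.scheme.update k).symm
    rw [hGs] at h1 h2
    refine ⟨ρ, hρ, fun _ ↦ ⟨?_, ?_⟩⟩
    · have e : 2 / (3 * (3 * L / (2 * μ))) = 4 * μ / (9 * L) := by field_simp; norm_num
      rwa [e] at h1
    · rwa [← hR.grad_succ, hR.G_step_step] at h2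
  · exact ⟨0, le_rfl, fun h ↦ absurd h hk⟩

/-- Superlinear convergence. -/
lemma localGradNorm_le_superlinear (hR : Run f B μ L M x G τ) {k : ℕ} (hk1 : 1 ≤ k)
    (hk : pathLength f M x k ≤ Real.log (3 / 2)) :
    localGradNorm f (x k) ≤ rateBase (Module.finrank ℝ E) μ L τ k ^ ((k : ℝ) / 2) *
      Real.sqrt (3 * L / (2 * μ)) * localGradNorm f (x 0) := by
  have hμ := hR.mu_pos
  have hL := hR.L_pos
  have hk0 : (0 : ℝ) < k := by exact_mod_cast hk1
  choose ρ hρ0 hρ using hR.exists_ratio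
  have hpath : ∀ i ∈ Finset.range k, pathLength f M x (i + 1) ≤ Real.log (3 / 2) := fun i hi ↦
    (pathLength_mono f hR.M_nonneg x (Finset.mem_range.1 hi)).trans hk
  have hp : ∀ i, 0 < weight μ L (τ i) := fun i ↦ (hR.weight_pos (hR.scheme.tau_mem i)).1
  have hsum : ∑ i ∈ Finset.range k, Real.log (1 + weight μ L (τ i) * ρ i) ≤
      13 / 6 * (Module.finrank ℝ E * Real.log (2 * L / μ)) := by
    have h1 := hR.sum_decrease_le k hk
    have h2 : 6 / 13 * ∑ i ∈ Finset.range k, Real.log (1 + weight μ L (τ i) * ρ i) ≤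
        ∑ i ∈ Finset.range k, decrease f x G i := by
      rw [Finset.mul_sum]
      exact Finset.sum_le_sum fun i hi ↦ (hρ i (hpath i hi)).1
    linarith
  have hgm := prod_rpow_le_exp_sub_one hk1 (x := fun i ↦ weight μ L (τ i) * ρ i)
    (fun i ↦ mul_nonneg (hp i).le (hρ0 i)) hsum
  -- The gradients are compared in the metrics of G_j⁻¹, where the one-step bounds multiply without
  -- loss. The factor 3L/(2μ) is then paid once, at the final return to H_k⁻¹; at the start H_0 ⪯
  -- G_0 costs nothing.
  have hdecay : ∀ j ≤ k, grad f (x j) ((G j).inverse (grad f (x j))) ≤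
      (∏ i ∈ Finset.range j, (5 / 2 * ρ i)) * grad f (x 0) ((G 0).inverse (grad f (x 0))) := by
    intro j hj
    induction j with
    | zero => simp
    | succ j ih =>
      have h1 := (hρ j (hpath j (Finset.mem_range.2 hj))).2
      have h2 := mul_le_mul_of_nonneg_left (ih (by omega))
        (mul_nonneg (by norm_num) (hρ0 j) : 0 ≤ 5 / 2 * ρ j)
      rw [Finset.prod_range_succ]
      linarith
  set P := ∏ i ∈ Finset.range k, weight μ L (τ i) ^ (1 / (k : ℝ)) with hP
  have hP0 : 0 < P := Finset.prod_pos fun i _ ↦ Real.rpow_pos_of_pos (hp i) _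
  have hQ0 := hR.rateBase_nonneg (Module.finrank ℝ E) k
  have hprod : ∏ i ∈ Finset.range k, (5 / 2 * ρ i) ≤
      rateBase (Module.finrank ℝ E) μ L τ k ^ k := by
    have e1 : ∏ i ∈ Finset.range k, (weight μ L (τ i) * ρ i) ^ (1 / (k : ℝ)) =
        P * ∏ i ∈ Finset.range k, ρ i ^ (1 / (k : ℝ)) := by
      rw [hP, ← Finset.prod_mul_distrib]
      exact Finset.prod_congr rfl fun i _ ↦ Real.mul_rpow (hp i).le (hρ0 i)
    have e2 : ∏ i ∈ Finset.range k, (5 / 2 * ρ i) =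
        (5 / 2 * ∏ i ∈ Finset.range k, ρ i ^ (1 / (k : ℝ))) ^ k := by
      rw [Finset.prod_mul_distrib, mul_pow, ← Finset.prod_pow]
      congr 1
      · rw [Finset.prod_const, Finset.card_range]
      · refine Finset.prod_congr rfl fun i _ ↦ ?_
        rw [← Real.rpow_natCast, ← Real.rpow_mul (hρ0 i), one_div_mul_cancel hk0.ne',
          Real.rpow_one]
    rw [e1] at hgm
    rw [e2]
    refine pow_le_pow_left₀ (mul_nonneg (by norm_num)
      (Finset.prod_nonneg fun i _ ↦ Real.rpow_nonneg (hρ0 i) _)) ?_ k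
    have e3 : 13 / 6 * (Module.finrank ℝ E * Real.log (2 * L / μ)) / k =
        13 / 6 * ((Module.finrank ℝ E : ℝ) / k) * Real.log (2 * L / μ) := by ring
    rw [e3] at hgm
    rw [rateBase, ← hP, div_mul_eq_mul_div 5 (2 * P), le_div_iff₀ (by positivity)]
    linarith
  have hG0 : G 0 = L • B := hR.scheme.init
  have h1 : localGradNorm f (x k) ^ 2 ≤
      3 * L / (2 * μ) * grad f (x k) ((G k).inverse (grad f (x k))) := by
    rw [hR.localGradNorm_sq]
    exact (hR.posDef_G k).inverse_le (hR.posDef_iterHess k) (by positivity)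
      (hR.iterHess_bounds hk).2 _
  have h2 : grad f (x 0) ((G 0).inverse (grad f (x 0))) ≤ localGradNorm f (x 0) ^ 2 := by
    rw [hR.localGradNorm_sq]
    have := (hR.posDef_iterHess 0).inverse_le (hR.posDef_G 0) one_pos
      (fun h ↦ by simpa [hG0, iterHess] using hR.le_L (x 0) h) (grad f (x 0))
    linarith
  have hlam := localGradNorm_nonneg f (x 0)
  have hbase : (rateBase (Module.finrank ℝ E) μ L τ k ^ ((k : ℝ) / 2)) ^ 2 =
      rateBase (Module.finrank ℝ E) μ L τ k ^ k := by
    rw [← Real.rpow_natCast, ← Real.rpow_mul hQ0, ← Real.rpow_natCast _ k]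
    congr 1
    push_cast
    ring
  refine (abs_le_of_sq_le_sq' ?_ (mul_nonneg (mul_nonneg (Real.rpow_nonneg hQ0 _)
    (Real.sqrt_nonneg _)) hlam)).2
  rw [mul_pow, mul_pow, hbase, Real.sq_sqrt (by positivity)]
  calc _ ≤ _ := h1
    _ ≤ 3 * L / (2 * μ) * (rateBase (Module.finrank ℝ E) μ L τ k ^ k *
        localGradNorm f (x 0) ^ 2) := by
      refine mul_le_mul_of_nonneg_left ((hdecay k le_rfl).trans ?_) (by positivity)
      exact mul_le_mul hprod h2 ((hR.posDef_G 0).apply_inverse_nonneg _) (pow_nonneg hQ0 k)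
    _ = _ := by ring

end Run

/-! ### The starting moment and the length of the path -/

lemma exp_sub_one_bound : 5 / 2 * (Real.exp (13 / 48) - 1) ≤ Real.exp (-(1 / 4)) := by
  -- The two sides differ by about 10⁻³, so each exponential is enclosed by a Taylor sum with five
  -- terms.
  have h1 := Real.exp_bound' (x := 13 / 48) (by norm_num) (by norm_num) (n := 5) (by norm_num)
  have h2 := (abs_le.1 (Real.exp_bound (x := -(1 / 4)) (by norm_num [abs_of_nonneg])
    (n := 5) (by norm_num))).1
  have e : |(-(1 / 4) : ℝ)| = 1 / 4 := by norm_num [abs_of_nonneg]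
  rw [e] at h2
  norm_num [Finset.sum_range_succ, Nat.factorial] at h1 h2 ⊢
  linarith

lemma exp_neg_eighth_le : Real.exp (-(1 / 8)) ≤ 8 / 9 := by
  rw [Real.exp_neg, inv_le_comm₀ (Real.exp_pos _) (by norm_num)]
  have := Real.add_one_le_exp (1 / 8 : ℝ)
  linarith

/-- `exp (p t) - 1 ≤ p (exp t - 1)` for `p ∈ [0, 1]`. -/
lemma exp_mul_sub_one_le {p : ℝ} (hp0 : 0 ≤ p) (hp1 : p ≤ 1) (t : ℝ) :
    Real.exp (p * t) - 1 ≤ p * (Real.exp t - 1) := by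
  have h := convexOn_exp.2 (Set.mem_univ t) (Set.mem_univ 0) hp0 (sub_nonneg.2 hp1) (by ring)
  simp only [smul_eq_mul, mul_zero, add_zero, Real.exp_zero, mul_one] at h
  linarith

lemma sum_geometric_le {q : ℝ} (hq0 : 0 ≤ q) (hq1 : q < 1) (n : ℕ) :
    ∑ i ∈ Finset.range n, q ^ i ≤ 1 / (1 - q) := by
  have h := mul_neg_geom_sum q n
  rw [le_div_iff₀ (by linarith)]
  have := pow_nonneg hq0 n
  linarith

/-- Truncated subtraction makes the bound 1 for the terms with j < K, which contribute K; the
geometric decay starts at j = K. -/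
lemma sum_le_of_geometric_tail {y : ℕ → ℝ} {K n : ℕ} {q : ℝ} (hq0 : 0 ≤ q) (hq1 : q < 1)
    (h : ∀ j < n, y j ≤ q ^ (j - K)) :
    ∑ j ∈ Finset.range n, y j ≤ K + 1 / (1 - q) := by
  calc ∑ j ∈ Finset.range n, y j ≤ ∑ j ∈ Finset.range n, q ^ (j - K) :=
        Finset.sum_le_sum fun j hj ↦ h j (Finset.mem_range.1 hj)
    _ ≤ ∑ j ∈ Finset.range (K + n), q ^ (j - K) :=
        Finset.sum_le_sum_of_subset_of_nonneg (Finset.range_mono (Nat.le_add_left n K))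
          fun j _ _ ↦ pow_nonneg hq0 _
    _ = K + ∑ i ∈ Finset.range n, q ^ i := by
        rw [Finset.sum_range_add]
        congr 1
        · rw [Finset.sum_congr rfl (g := fun _ ↦ (1 : ℝ)) fun j hj ↦ by
            rw [Nat.sub_eq_zero_of_le (Finset.mem_range.1 hj).le, pow_zero]]
          simp
        · simp
    _ ≤ _ := by
        have := sum_geometric_le hq0 hq1 n
        linarith

namespace Run

variable {E : Type*} [NormedAddCommGroup E] [NormedSpace ℝ E]
  {f : E → ℝ} {B : Op E} {μ L M : ℝ} {x : ℕ → E} {G : ℕ → Op E} {τ : ℕ → ℝ}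

lemma iSup_tau_mem (hR : Run f B μ L M x G τ) :
    (⨆ k, τ k) ∈ Set.Icc (0 : ℝ) 1 ∧ ∀ i, τ i ≤ ⨆ k, τ k := by
  have hbdd : BddAbove (Set.range τ) := ⟨1, by
    rintro _ ⟨k, rfl⟩
    exact (hR.scheme.tau_mem k).2⟩
  have hle := le_ciSup hbdd
  exact ⟨⟨(hR.scheme.tau_mem 0).1.trans (hle 0), ciSup_le fun k ↦ (hR.scheme.tau_mem k).2⟩, hle⟩

/-- The weight is nonincreasing in τ because 4μ/(9L) ≤ 1. -/
lemma weight_iSup_le (hR : Run f B μ L M x G τ) (i : ℕ) :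
    weight μ L (⨆ k, τ k) ≤ weight μ L (τ i) := by
  have h1 := hR.iSup_tau_mem.2 i
  have h2 : 4 * μ / (9 * L) ≤ 1 := by
    rw [div_le_one (by linarith [hR.L_pos])]; linarith [hR.mu_le_L, hR.mu_pos]
  rw [weight, weight]
  nlinarith

/-- From the starting moment on, the base of the superlinear rate is at most `exp (-1/4)`. -/
lemma rateBase_le (hR : Run f B μ L M x G τ) (n : ℕ) {k : ℕ}
    (hk : startMoment n μ L (⨆ k, τ k) ≤ k) :
    rateBase n μ L τ k ≤ Real.exp (-(1 / 4)) := by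
  obtain ⟨hp0, hp1⟩ := hR.weight_pos hR.iSup_tau_mem.1
  have hw := hR.weight_iSup_le
  have hlog := hR.log_two_cond_nonneg
  have hK := (max_le_iff.1 hk)
  have hk0 : (0 : ℝ) < k := by exact_mod_cast hK.1
  have hk2 := Nat.ceil_le.1 hK.2
  set p := weight μ L (⨆ k, τ k) with hp
  have hP : p ≤ ∏ i ∈ Finset.range k, weight μ L (τ i) ^ (1 / (k : ℝ)) := by
    calc p = ∏ _i ∈ Finset.range k, p ^ (1 / (k : ℝ)) := by
          rw [Finset.prod_const, Finset.card_range, ← Real.rpow_natCast, ← Real.rpow_mul hp0.le,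
            one_div_mul_cancel hk0.ne', Real.rpow_one]
      _ ≤ _ := Finset.prod_le_prod (fun i _ ↦ Real.rpow_nonneg hp0.le _) fun i _ ↦
          Real.rpow_le_rpow hp0.le (hw i) (by positivity)
  -- The number 13/48 is 13/6 divided by the 8 in the definition of K₀. Convexity of exp then
  -- extracts p linearly, so that it cancels against the product of the weights.
  have ht : 13 / 6 * ((n : ℝ) / k) * Real.log (2 * L / μ) ≤ p * (13 / 48) := by
    rw [div_mul_eq_mul_div, one_mul, div_le_iff₀ hp0] at hk2
    have e : 13 / 6 * ((n : ℝ) / k) * Real.log (2 * L / μ) =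
        13 / 48 * (8 * n * Real.log (2 * L / μ)) / k := by ring
    rw [e, div_le_iff₀ hk0]
    linarith
  have h1 : Real.exp (13 / 6 * ((n : ℝ) / k) * Real.log (2 * L / μ)) - 1 ≤
      p * (Real.exp (13 / 48) - 1) := by
    have := exp_mul_sub_one_le hp0.le hp1 (13 / 48)
    have := Real.exp_le_exp.2 ht
    linarith
  have h2 : 0 ≤ Real.exp (13 / 48 : ℝ) - 1 := by
    linarith [Real.one_le_exp (x := 13 / 48) (by norm_num)]
  refine le_trans ?_ exp_sub_one_bound
  have hP0 := hp0.trans_le hP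
  rw [rateBase, div_mul_eq_mul_div, div_le_iff₀ (by positivity)]
  have h3 := mul_le_mul_of_nonneg_right hP h2
  linarith

variable [FiniteDimensional ℝ E]

lemma localGradNorm_le_tail (hR : Run f B μ L M x G τ) (hn : 1 ≤ Module.finrank ℝ E) {k : ℕ}
    (hK : startMoment (Module.finrank ℝ E) μ L (⨆ k, τ k) ≤ k)
    (hk : pathLength f M x k ≤ Real.log (3 / 2)) :
    localGradNorm f (x k) ≤ Real.sqrt (3 / 2) * localGradNorm f (x 0) *
      (8 / 9 : ℝ) ^ (k - startMoment (Module.finrank ℝ E) μ L (⨆ k, τ k)) := by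
  have hμ := hR.mu_pos
  have hL := hR.L_pos
  have hlog := hR.log_two_cond_nonneg
  obtain ⟨hp0, hp1⟩ := hR.weight_pos hR.iSup_tau_mem.1
  have hrate := hR.rateBase_le _ hK
  have hQ0 := hR.rateBase_nonneg (Module.finrank ℝ E) k
  have hlam := localGradNorm_nonneg f (x 0)
  set K := startMoment (Module.finrank ℝ E) μ L (⨆ k, τ k) with hKdef
  have hk1 : 1 ≤ k := (le_max_left _ _).trans hK
  have h1 := hR.localGradNorm_le_superlinear hk1 hk
  -- This needs n ≥ 1. It makes e^{-K/8} at most μ/(2L), which absorbs the factor √(3L/(2μ)) and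
  -- leaves √(3/2), as in the linear bound.
  have hKlog : 8 * Real.log (2 * L / μ) ≤ K := by
    have h2 : 1 / weight μ L (⨆ k, τ k) *
        (8 * (Module.finrank ℝ E) * Real.log (2 * L / μ)) ≤ K :=
      (Nat.le_ceil _).trans (Nat.cast_le.2 (le_max_right _ _))
    have hn' : (1 : ℝ) ≤ Module.finrank ℝ E := by exact_mod_cast hn
    have h3 : 8 * Real.log (2 * L / μ) ≤ 8 * (Module.finrank ℝ E) * Real.log (2 * L / μ) := by
      nlinarith
    have h4 : (1 : ℝ) ≤ 1 / weight μ L (⨆ k, τ k) := by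
      rw [le_div_iff₀ hp0]; linarith
    have h5 : 0 ≤ 8 * (Module.finrank ℝ E) * Real.log (2 * L / μ) := by positivity
    nlinarith
  have hpow : rateBase (Module.finrank ℝ E) μ L τ k ^ ((k : ℝ) / 2) ≤
      Real.exp (-(K / 8)) * (8 / 9) ^ (k - K) := by
    calc _ ≤ Real.exp (-(1 / 4)) ^ ((k : ℝ) / 2) := Real.rpow_le_rpow hQ0 hrate (by positivity)
      _ = Real.exp (-(K / 8)) * Real.exp (-(1 / 8)) ^ (k - K) := by
        rw [← Real.exp_mul, ← Real.exp_nat_mul, ← Real.exp_add, Nat.cast_sub hK]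
        congr 1
        ring
      _ ≤ _ := by
        gcongr
        exact exp_neg_eighth_le
  have hexp : Real.exp (-(K / 8)) ≤ μ / (2 * L) := by
    calc _ ≤ Real.exp (-Real.log (2 * L / μ)) := Real.exp_le_exp.2 (by linarith)
      _ = _ := by rw [Real.exp_neg, Real.exp_log (by positivity), inv_div]
  have hsqrt : μ / (2 * L) * Real.sqrt (3 * L / (2 * μ)) ≤ Real.sqrt (3 / 2) := by
    have h6 := hR.one_le_cond
    have e : 3 * L / (2 * μ) = 3 / 2 * (L / μ) := by ring
    have h7 : Real.sqrt (L / μ) ≤ L / μ :=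
      Real.sqrt_le_iff.2 ⟨by linarith, by nlinarith⟩
    rw [e, Real.sqrt_mul (by norm_num)]
    have h8 : μ / (2 * L) * Real.sqrt (L / μ) ≤ 1 := by
      calc _ ≤ μ / (2 * L) * (L / μ) := by gcongr
        _ = 1 / 2 := by field_simp
        _ ≤ 1 := by norm_num
    have := mul_le_mul_of_nonneg_left h8 (Real.sqrt_nonneg (3 / 2))
    linarith
  calc _ ≤ _ := h1
    _ ≤ (μ / (2 * L) * (8 / 9) ^ (k - K)) * Real.sqrt (3 * L / (2 * μ)) *
        localGradNorm f (x 0) := by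
      gcongr
      exact hpow.trans (by gcongr)
    _ = (μ / (2 * L) * Real.sqrt (3 * L / (2 * μ))) * localGradNorm f (x 0) *
        (8 / 9) ^ (k - K) := by ring
    _ ≤ _ := by gcongr

/-- The path of the iterates stays in the region of convergence. -/
lemma pathLength_le (hR : Run f B μ L M x G τ) (hn : 1 ≤ Module.finrank ℝ E)
    (hinit : M * localGradNorm f (x 0) ≤
      Real.log (3 / 2) / (3 / 2 : ℝ) ^ (3 / 2 : ℝ) *
        max (μ / (2 * L))
          (1 / ((startMoment (Module.finrank ℝ E) μ L (⨆ k, τ k) : ℝ) + 9))) (k : ℕ) :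
    pathLength f M x k ≤ Real.log (3 / 2) := by
  have hμ := hR.mu_pos
  have hL := hR.L_pos
  have hM := hR.M_nonneg
  have hlog : 0 < Real.log (3 / 2 : ℝ) := Real.log_pos (by norm_num)
  have hlam := localGradNorm_nonneg f (x 0)
  induction k with
  | zero => simpa [pathLength] using hlog.le
  | succ k ih =>
    have hj : ∀ j ≤ k, pathLength f M x j ≤ Real.log (3 / 2) := fun j h ↦
      (pathLength_mono f hM x h).trans ih
    set K := startMoment (Module.finrank ℝ E) μ L (⨆ k, τ k) with hK
    set S := Real.sqrt (3 / 2) * localGradNorm f (x 0) with hS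
    have hS0 : 0 ≤ S := by positivity
    obtain ⟨hq1, hq2⟩ := hR.rate_mem
    have hq0 : 0 ≤ 1 - μ / (2 * L) := by linarith
    have hqlt : 1 - μ / (2 * L) < 1 := by
      have : 0 < μ / (2 * L) := by positivity
      linarith
    have hlin : ∀ j ≤ k, localGradNorm f (x j) ≤ S * (1 - μ / (2 * L)) ^ j := fun j h ↦ by
      have := hR.localGradNorm_le_linear (hj j h)
      rw [hS]
      linarith
    have hsum1 : ∑ j ∈ Finset.range (k + 1), localGradNorm f (x j) ≤ S * (2 * L / μ) := by
      calc _ ≤ ∑ j ∈ Finset.range (k + 1), S * (1 - μ / (2 * L)) ^ j :=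
            Finset.sum_le_sum fun j h ↦ hlin j (Nat.lt_succ_iff.1 (Finset.mem_range.1 h))
        _ = S * ∑ j ∈ Finset.range (k + 1), (1 - μ / (2 * L)) ^ j := by rw [Finset.mul_sum]
        _ ≤ S * (1 / (1 - (1 - μ / (2 * L)))) :=
            mul_le_mul_of_nonneg_left (sum_geometric_le hq0 hqlt _) hS0
        _ = _ := by rw [sub_sub_cancel, one_div_div]
    -- Up to K the linear bound gives S per term; afterwards the decay 8/9 sums to 1/(1 − 8/9) = 9.
    -- The case S = 0 is separate because the terms are divided by S.
    have hsum2 : ∑ j ∈ Finset.range (k + 1), localGradNorm f (x j) ≤ S * (K + 9) := by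
      rcases hS0.eq_or_lt with h0 | h0
      · have h3 := hsum1
        rw [← h0, zero_mul] at h3 ⊢
        exact h3
      have h4 := sum_le_of_geometric_tail (y := fun j ↦ localGradNorm f (x j) / S) (K := K)
        (n := k + 1) (q := 8 / 9) (by norm_num) (by norm_num) fun j h ↦ by
          rw [div_le_iff₀' h0]
          have hjk := Nat.lt_succ_iff.1 h
          rcases le_total K j with hKj | hKj
          · exact hR.localGradNorm_le_tail hn hKj (hj j hjk)
          · rw [Nat.sub_eq_zero_of_le hKj, pow_zero]
            exact (hlin j hjk).trans
              (mul_le_mul_of_nonneg_left (pow_le_one₀ hq0 hq2) hS0)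
      rw [← Finset.sum_div, div_le_iff₀' h0] at h4
      norm_num at h4
      exact h4
    have hpath : pathLength f M x (k + 1) ≤
        3 / 2 * M * ∑ j ∈ Finset.range (k + 1), localGradNorm f (x j) := by
      have e : 3 / 2 * M * ∑ j ∈ Finset.range (k + 1), localGradNorm f (x j) =
          M * ∑ j ∈ Finset.range (k + 1), 3 / 2 * localGradNorm f (x j) := by
        rw [← Finset.mul_sum]
        ring
      rw [e]
      exact mul_le_mul_of_nonneg_left (Finset.sum_le_sum fun j h ↦
        hR.stepNorm_le (hj j (Nat.lt_succ_iff.1 (Finset.mem_range.1 h)))) hM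
    -- The factor 3/2 comes from `stepNorm_le` and √(3/2) from the bounds on λ_j, hidden in S.
    have hc : (3 / 2 : ℝ) ^ (3 / 2 : ℝ) = 3 / 2 * Real.sqrt (3 / 2) := by
      rw [Real.sqrt_eq_rpow, show (3 / 2 : ℝ) ^ (3 / 2 : ℝ) = (3 / 2 : ℝ) ^ ((1 : ℝ) + 1 / 2) by
        norm_num, Real.rpow_add (by norm_num), Real.rpow_one]
    have hc0 : (0 : ℝ) < 3 / 2 * Real.sqrt (3 / 2) := by positivity
    rw [hc] at hinit
    have hfin : ∀ T : ℝ, 0 < T → ∑ j ∈ Finset.range (k + 1), localGradNorm f (x j) ≤ S * T →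
        M * localGradNorm f (x 0) ≤ Real.log (3 / 2) / (3 / 2 * Real.sqrt (3 / 2)) * (1 / T) →
        pathLength f M x (k + 1) ≤ Real.log (3 / 2) := by
      intro T hT h1 h2
      rw [div_mul_div_comm, mul_one, le_div_iff₀ (by positivity)] at h2
      have h3 := mul_le_mul_of_nonneg_left h1 (by positivity : 0 ≤ 3 / 2 * M)
      rw [hS] at h3
      linarith
    rcases le_total (μ / (2 * L)) (1 / ((K : ℝ) + 9)) with h | h
    · rw [max_eq_right h] at hinit
      exact hfin _ (by positivity) hsum2 hinit
    · rw [max_eq_left h] at hinit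
      refine hfin _ (by positivity) hsum1 ?_
      rwa [one_div_div]

end Run

end QuasiNewton

theorem mainTheorem1 {E : Type*} [NormedAddCommGroup E] [NormedSpace ℝ E] [FiniteDimensional ℝ E]
    (f : E → ℝ) (hf : ContDiff ℝ 2 f)
    (B : QuasiNewton.Op E) (hB : QuasiNewton.IsPosDef B)
    (μ L M : ℝ) (hμ : 0 < μ) (hL : 0 < L) (hM : 0 ≤ M)
    (hμL : ∀ x : E, QuasiNewton.OpLE (μ • B) (QuasiNewton.hess f x) ∧
      QuasiNewton.OpLE (QuasiNewton.hess f x) (L • B))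
    (hsc : QuasiNewton.StronglySelfConcordant f M)
    (x : ℕ → E) (G : ℕ → QuasiNewton.Op E) (τ : ℕ → ℝ)
    (hscheme : QuasiNewton.IsScheme f B L x G τ)
    (hinit : M * QuasiNewton.localGradNorm f (x 0) ≤
      Real.log (3 / 2) / (3 / 2 : ℝ) ^ (3 / 2 : ℝ) *
        max (μ / (2 * L))
          (1 / ((QuasiNewton.startMoment (Module.finrank ℝ E) μ L (⨆ k, τ k) : ℝ) + 9))) :
    (∀ k : ℕ,
      QuasiNewton.OpLE ((2 / 3 : ℝ) • QuasiNewton.hess f (x k)) (G k) ∧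
      QuasiNewton.OpLE (G k) ((3 * L / (2 * μ)) • QuasiNewton.hess f (x k))) ∧
    (∀ k : ℕ,
      QuasiNewton.localGradNorm f (x k) ≤
        (1 - μ / (2 * L)) ^ k * Real.sqrt (3 / 2) * QuasiNewton.localGradNorm f (x 0)) ∧
    (∀ k : ℕ, 1 ≤ k →
      QuasiNewton.localGradNorm f (x k) ≤
        (5 / (2 * ∏ i ∈ Finset.range k, QuasiNewton.weight μ L (τ i) ^ (1 / (k : ℝ))) *
            (Real.exp (13 / 6 * ((Module.finrank ℝ E : ℝ) / k) * Real.log (2 * L / μ)) - 1)) ^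
              ((k : ℝ) / 2) *
          Real.sqrt (3 * L / (2 * μ)) * QuasiNewton.localGradNorm f (x 0)) := by
  -- In dimension zero μ ≤ L does not follow from the hypotheses, but every norm vanishes. Otherwise
  -- a nonzero vector gives μ ≤ L.
  rcases subsingleton_or_nontrivial E with hE | hE
  · have hzero : ∀ y : E, QuasiNewton.localGradNorm f y = 0 := fun y ↦ by
      rw [QuasiNewton.localGradNorm, QuasiNewton.dualNorm,
        Subsingleton.elim (QuasiNewton.grad f y) 0]
      simp
    refine ⟨fun k ↦ ⟨fun h ↦ ?_, fun h ↦ ?_⟩, fun k ↦ by simp [hzero], fun k _ ↦ by simp [hzero]⟩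
    all_goals
      rw [Subsingleton.elim h 0]
      simp
  · have hmu : ∀ y h, μ * B h h ≤ QuasiNewton.hess f y h h := fun y h ↦ by
      simpa using QuasiNewton.opLE_iff.1 (hμL y).1 h
    have hLB : ∀ y h, QuasiNewton.hess f y h h ≤ L * B h h := fun y h ↦ by
      simpa using QuasiNewton.opLE_iff.1 (hμL y).2 h
    have hle : μ ≤ L := by
      obtain ⟨v, hv⟩ := exists_ne (0 : E)
      exact le_of_mul_le_mul_right ((hmu 0 v).trans (hLB 0 v)) (hB.pos v hv)
    have hR : QuasiNewton.Run f B μ L M x G τ :=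
      ⟨hf, hB, hμ, hL, hle, hM, hmu, hLB, hsc, hscheme⟩
    have hpath := hR.pathLength_le Module.finrank_pos hinit
    refine ⟨fun k ↦ ?_, fun k ↦ hR.localGradNorm_le_linear (hpath k),
      fun k hk ↦ hR.localGradNorm_le_superlinear hk (hpath k)⟩
    obtain ⟨h1, h2⟩ := hR.iterHess_bounds (hpath k)
    refine ⟨QuasiNewton.opLE_iff.2 fun h ↦ ?_, QuasiNewton.opLE_iff.2 fun h ↦ h2 h⟩
    have := h1 h
    change 2 / 3 * QuasiNewton.iterHess f x k h h ≤ _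
    linarith
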